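/- Let $d\in\mathbb N$, $z\in\mathbb R^d$, let $W=(W_t)_{t\ge 0}$ be a standard $d$-dimensional Brownian motion on a probability space, and for $\beta\in(0,1)$ let $$X^{\beta,z}_t := z+\sqrt{\beta}\int_0^t\Big(\frac{t}{s}\Big)^{\frac{1-\beta}{2}}\,dW_s,\qquad t\ge 0,$$ where for each $t$ the stochastic integral (with deterministic, square integrable integrand) is the Wiener integral, defined up to null sets. Let $X^{0,z}_t := z+\eta\sqrt t$, $t\ge0$, where $\eta$ is an $\mathbb R^d$-valued random variable with standard normal law $\mathcal N(0,1_d)$, possibly on another probability space. Then: (i) For every $\beta\in(0,1)$ the process $X^{\beta,z}$ has a continuous version, and for every continuous version almost surely the path is, for all $\gamma\in(0,1/2)$ and all $T\geq 0$, Hölder continuous of order $\gamma$ on $[0,T]$. (ii) Denote by $X^{\beta,z}$ also any continuous version of it. For every $T>0$, as $\beta\to0$ with $\beta\in(0,1)$, the $C([0,T];\mathbb R^d)$-valued random variables $X^{\beta,z}|_{[0,T]}$ converge in distribution to $X^{0,z}|_{[0,T]}$, where $C([0,T];\mathbb R^d)$ carries the topology of uniform convergence and its Borel $\sigma$-algebra.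 -/

import Mathlib

open MeasureTheory ProbabilityTheory Filter Topology
open scoped NNReal ENNReal

noncomputable section

/-- `W` is a standard `d`-dimensional Brownian motion under `P`: its coordinate processes are
real standard Brownian motions, independent of one another (as processes). -/
structure IsBrownianMotion {Ω : Type*} [MeasurableSpace Ω] {d : ℕ}
    (W : ℝ≥0 → Ω → EuclideanSpace ℝ (Fin d)) (P : Measure Ω) : Prop where
  isBrownianReal : ∀ i : Fin d, IsBrownianReal (fun t ω ↦ W t ω i) P
  indep : iIndepFun (fun (i : Fin d) (ω : Ω) (t : ℝ≥0) ↦ W t ω i) P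

/-- A formal finite linear combination of indicator functions of intervals `(a, b]` of the
half line. -/
structure StepData where
  n : ℕ
  coeff : Fin n → ℝ
  left : Fin n → ℝ≥0
  right : Fin n → ℝ≥0
  le : ∀ k, left k ≤ right k

/-- The step function `∑ₖ cₖ 1_{(aₖ, bₖ]}`. -/
def StepData.toFun (φ : StepData) (s : ℝ) : ℝ :=
  ∑ k, (Set.Ioc (φ.left k : ℝ) (φ.right k)).indicator (fun _ ↦ φ.coeff k) s

/-- The stochastic integral `∑ₖ cₖ (B_{bₖ} - B_{aₖ})` of a step function. -/
def StepData.integral (φ : StepData) {Ω : Type*} (B : ℝ≥0 → Ω → ℝ) (ω : Ω) : ℝ :=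
  ∑ k, φ.coeff k * (B (φ.right k) ω - B (φ.left k) ω)

/-- `I` is (a version of) the Wiener integral `∫₀^∞ f(s) dB_s` of the deterministic integrand
`f ∈ L²(0, ∞)`: it is the `L²(P)`-limit of the integrals of step functions
that converge to `f` in `L²(0, ∞)`. -/
structure IsWienerIntegral {Ω : Type*} [MeasurableSpace Ω] (B : ℝ≥0 → Ω → ℝ) (P : Measure Ω)
    (f : ℝ → ℝ) (I : Ω → ℝ) : Prop where
  memLp_integrand : MemLp f 2 (volume.restrict (Set.Ioi 0))
  memLp_integral : MemLp I 2 P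
  exists_approx : ∃ φ : ℕ → StepData,
    Tendsto (fun n ↦ eLpNorm (fun s ↦ (φ n).toFun s - f s) 2 (volume.restrict (Set.Ioi 0)))
      atTop (𝓝 0) ∧
    Tendsto (fun n ↦ eLpNorm (fun ω ↦ (φ n).integral B ω - I ω) 2 P) atTop (𝓝 0)

open Classical in
/-- The Wiener integral `∫₀^∞ f(s) dB_s` (one representative of its almost sure equivalence
class; `0` if the integral does not exist). -/
def wienerIntegral {Ω : Type*} [MeasurableSpace Ω] (B : ℝ≥0 → Ω → ℝ) (P : Measure Ω)
    (f : ℝ → ℝ) : Ω → ℝ :=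
  if h : ∃ I, IsWienerIntegral B P f I then h.choose else fun _ ↦ 0

/-- The integrand `s ↦ 1_{(0, t]}(s) (t / s)^{(1 - β) / 2}`. -/
def interpolationKernel (β : ℝ) (t : ℝ≥0) : ℝ → ℝ :=
  (Set.Ioc (0 : ℝ) t).indicator fun s ↦ ((t : ℝ) / s) ^ ((1 - β) / 2)

/-- The process `X_t = z + √β ∫₀ᵗ (t / s)^{(1 - β) / 2} dW_s`, the integral with respect to the
`d`-dimensional process `W` being taken coordinatewise. -/
def interpolationProcess {Ω : Type*} [MeasurableSpace Ω] {d : ℕ}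
    (W : ℝ≥0 → Ω → EuclideanSpace ℝ (Fin d)) (P : Measure Ω) (β : ℝ)
    (z : EuclideanSpace ℝ (Fin d)) (t : ℝ≥0) (ω : Ω) : EuclideanSpace ℝ (Fin d) :=
  z + Real.sqrt β • WithLp.toLp 2
    (fun i ↦ wienerIntegral (fun t ω ↦ W t ω i) P (interpolationKernel β t) ω)

/-- `Y` is a version of the process `X` all of whose paths are continuous. -/
def IsContinuousVersion {Ω E : Type*} [MeasurableSpace Ω] [TopologicalSpace E]
    (X : ℝ≥0 → Ω → E) (P : Measure Ω) (Y : Ω → C(ℝ≥0, E)) : Prop :=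
  ∀ t, (fun ω ↦ Y ω t) =ᵐ[P] X t

/-- The path `t ↦ z + √t c`. -/
def sqrtPath {d : ℕ} (z c : EuclideanSpace ℝ (Fin d)) : C(ℝ≥0, EuclideanSpace ℝ (Fin d)) where
  toFun t := z + Real.sqrt (t : ℝ) • c
  continuous_toFun := by fun_prop

/-- The space of continuous paths on `[0, T]` carries its Borel `σ`-algebra (the topology is that
of uniform convergence). -/
instance pathMeasurableSpace (d : ℕ) (T : ℝ≥0) :
    MeasurableSpace C(Set.Icc (0 : ℝ≥0) T, EuclideanSpace ℝ (Fin d)) := borel _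

instance pathBorelSpace (d : ℕ) (T : ℝ≥0) :
    BorelSpace C(Set.Icc (0 : ℝ≥0) T, EuclideanSpace ℝ (Fin d)) := ⟨rfl⟩

end

/-! Everything rests on one covariance. By the Itô isometry, each coordinate of `X^{β,z} - z` is a
centred Gaussian process with covariance `(st)^((1-β)/2) min(s,t)^β`: the factor `β` cancels the
`1/β` that comes from integrating `u^(β-1)`.

For `s ≤ t` this covariance is at least `s`, so an increment has variance at most `t - s`, whatever
`β` is. All even moments of increments are then bounded uniformly in `β` by powers of `|t - s|`, and
dyadic chaining gives a continuous version and Hölder continuity of every order below `1/2`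
(`exists_isContinuousVersion`, `ae_exists_holderOnWith`).

For the limit `β → 0`, put `D_t = (X_t - z) - √t (X_1 - z)`. The vector `X_1 - z` is standard normal
for every `β`, so `z + √t (X_1 - z)` already has the limit law. The coordinate variance of `D_t` is
`2t - 2√t t^((1-β)/2) min(t,1)^β`, which tends to `0`. Since the increments of `D` also have moment
bounds uniform in `β`, `D` tends to `0` in probability uniformly on `[0,T]`
(`tendstoInMeasure_restrict_zero`), and Slutsky's theorem concludes.

Wiener integrals are known only as `L²` limits of step integrals, so their laws are obtained by
passing to the limit in characteristic functions. -/

section SquareIntegrable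

/-! ### Convergence in `L²` and its effect on second moments and characteristic functions. -/

variable {α : Type*} [MeasurableSpace α] {μ : Measure α}

lemma toReal_eLpNorm_two_sq {f : α → ℝ} (hf : MemLp f 2 μ) :
    (eLpNorm f 2 μ).toReal ^ 2 = ∫ x, f x ^ 2 ∂μ := by
  rw [hf.eLpNorm_eq_integral_rpow_norm (by norm_num) (by norm_num)]
  have h0 : 0 ≤ ∫ x, f x ^ 2 ∂μ := integral_nonneg fun x ↦ sq_nonneg _
  simp only [ENNReal.toReal_ofNat, Real.rpow_two, Real.norm_eq_abs, sq_abs]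
  rw [ENNReal.toReal_ofReal (by positivity), ← Real.rpow_two, ← Real.rpow_mul h0]
  norm_num

lemma eLpNorm_two_eq_of_integral_sq_eq {β : Type*} [MeasurableSpace β] {ν : Measure β}
    {f : α → ℝ} {g : β → ℝ} (hf : MemLp f 2 μ) (hg : MemLp g 2 ν)
    (h : ∫ x, f x ^ 2 ∂μ = ∫ x, g x ^ 2 ∂ν) : eLpNorm f 2 μ = eLpNorm g 2 ν := by
  rw [← toReal_eLpNorm_two_sq hf, ← toReal_eLpNorm_two_sq hg] at h
  rw [← ENNReal.toReal_eq_toReal_iff' hf.eLpNorm_ne_top hg.eLpNorm_ne_top]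
  exact (sq_eq_sq₀ ENNReal.toReal_nonneg ENNReal.toReal_nonneg).1 h

lemma tendsto_integral_sq_of_tendsto_eLpNorm {f : ℕ → α → ℝ} {g : α → ℝ}
    (hf : ∀ n, MemLp (f n) 2 μ) (hg : MemLp g 2 μ)
    (h : Tendsto (fun n ↦ eLpNorm (fun x ↦ f n x - g x) 2 μ) atTop (𝓝 0)) :
    Tendsto (fun n ↦ ∫ x, f n x ^ 2 ∂μ) atTop (𝓝 (∫ x, g x ^ 2 ∂μ)) := by
  have h1 := (Lp.tendsto_Lp_iff_tendsto_eLpNorm'' f hf g hg).2 h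
  have h2 := (h1.norm).pow 2
  simp only [Lp.norm_toLp, toReal_eLpNorm_two_sq (hf _), toReal_eLpNorm_two_sq hg] at h2
  exact h2

lemma tendsto_eLpNorm_linComb {u v : ℕ → α → ℝ} {u' v' : α → ℝ} (a b : ℝ)
    (hum : ∀ n, MemLp (u n) 2 μ) (hvm : ∀ n, MemLp (v n) 2 μ) (hu'm : MemLp u' 2 μ)
    (hv'm : MemLp v' 2 μ)
    (hu : Tendsto (fun n ↦ eLpNorm (fun x ↦ u n x - u' x) 2 μ) atTop (𝓝 0))
    (hv : Tendsto (fun n ↦ eLpNorm (fun x ↦ v n x - v' x) 2 μ) atTop (𝓝 0)) :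
    Tendsto (fun n ↦ eLpNorm (fun x ↦ (a * u n x + b * v n x) - (a * u' x + b * v' x)) 2 μ)
      atTop (𝓝 0) := by
  have hlim : Tendsto (fun n ↦ ‖a‖ₑ * eLpNorm (fun x ↦ u n x - u' x) 2 μ +
      ‖b‖ₑ * eLpNorm (fun x ↦ v n x - v' x) 2 μ) atTop (𝓝 0) := by
    simpa using (ENNReal.Tendsto.const_mul hu (Or.inr enorm_ne_top)).add
      (ENNReal.Tendsto.const_mul hv (Or.inr enorm_ne_top))
  refine tendsto_of_tendsto_of_tendsto_of_le_of_le tendsto_const_nhds hlim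
    (fun _ ↦ zero_le) fun n ↦ ?_
  have e : (fun x ↦ (a * u n x + b * v n x) - (a * u' x + b * v' x)) =
      (a • fun x ↦ u n x - u' x) + (b • fun x ↦ v n x - v' x) := by
    ext x; simp; ring
  simp only [e]
  refine (eLpNorm_add_le (((hum n).sub hu'm).1.const_smul a)
    (((hvm n).sub hv'm).1.const_smul b) (by norm_num)).trans (le_of_eq ?_)
  rw [eLpNorm_const_smul, eLpNorm_const_smul]
  rfl

/-- Convergence in `L²` implies convergence in measure, hence in distribution. Laws of step
integrals reach Wiener integrals this way. -/
lemma tendsto_charFun_map_of_tendsto_eLpNorm [IsProbabilityMeasure μ] {f : ℕ → α → ℝ} {g : α → ℝ}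
    (hf : ∀ n, MemLp (f n) 2 μ) (hg : MemLp g 2 μ)
    (h : Tendsto (fun n ↦ eLpNorm (fun x ↦ f n x - g x) 2 μ) atTop (𝓝 0)) (t : ℝ) :
    Tendsto (fun n ↦ charFun (μ.map (f n)) t) atTop (𝓝 (charFun (μ.map g) t)) := by
  have h1 : TendstoInMeasure μ f atTop g := tendstoInMeasure_of_tendsto_eLpNorm two_ne_zero
    (fun n ↦ (hf n).1) hg.1 h
  exact ProbabilityMeasure.tendsto_iff_tendsto_charFun.1
    (h1.tendstoInDistribution fun n ↦ (hf n).1.aemeasurable).tendsto t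

end SquareIntegrable

/-! ### Stochastic integrals of step functions. -/

namespace StepData

variable {Ω : Type*} [MeasurableSpace Ω] {B : ℝ≥0 → Ω → ℝ} {P : Measure Ω}

lemma memLp_toFun (φ : StepData) (p : ℝ≥0∞) : MemLp φ.toFun p (volume.restrict (Set.Ioi 0)) := by
  refine (memLp_finsetSum Finset.univ fun k _ ↦ memLp_indicator_const p
    (measurableSet_Ioc (a := (φ.left k : ℝ)) (b := φ.right k)) (φ.coeff k) (Or.inr ?_))
  exact ((Measure.restrict_apply_le _ _).trans_lt measure_Ioc_lt_top).ne

/-- The `L²` inner product of the indicator functions of the intervals `(a, b]` and `(a', b']`. -/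
lemma measureReal_Ioc_inter_Ioc {a b a' b' : ℝ≥0} (h : a ≤ b) (h' : a' ≤ b') :
    (volume.restrict (Set.Ioi (0 : ℝ))).real (Set.Ioc (a : ℝ) b ∩ Set.Ioc (a' : ℝ) b') =
      min (b : ℝ) b' - min (b : ℝ) a' - min (a : ℝ) b' + min (a : ℝ) a' := by
  rw [measureReal_restrict_apply (measurableSet_Ioc.inter measurableSet_Ioc),
    Set.inter_eq_left.2, Set.Ioc_inter_Ioc, Real.volume_real_Ioc]
  · have h1 : (a : ℝ) ≤ b := h
    have h2 : (a' : ℝ) ≤ b' := h'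
    simp only [max_def, min_def]
    grind
  · exact fun x hx ↦ a.2.trans_lt hx.1.1

/-- Expanded into minima so that it matches, term by term, the covariances of Brownian increments in
`variance_integral`. The intervals may overlap, hence the double sum. -/
lemma integral_sq_toFun (φ : StepData) :
    ∫ s in Set.Ioi 0, φ.toFun s ^ 2 = ∑ j, ∑ k, φ.coeff j * φ.coeff k *
      (min (φ.right j : ℝ) (φ.right k) - min (φ.right j : ℝ) (φ.left k)
        - min (φ.left j : ℝ) (φ.right k) + min (φ.left j : ℝ) (φ.left k)) := by
  have h (s : ℝ) : φ.toFun s ^ 2 = ∑ j, ∑ k,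
      (Set.Ioc (φ.left j : ℝ) (φ.right j) ∩ Set.Ioc (φ.left k : ℝ) (φ.right k)).indicator
        (fun _ ↦ φ.coeff j * φ.coeff k) s := by
    simp only [toFun, sq, Finset.sum_mul_sum, Set.inter_indicator_mul]
  have hint (j k : Fin φ.n) : Integrable
      ((Set.Ioc (φ.left j : ℝ) (φ.right j) ∩ Set.Ioc (φ.left k : ℝ) (φ.right k)).indicator
        (fun _ ↦ φ.coeff j * φ.coeff k)) (volume.restrict (Set.Ioi 0)) := by
    refine (integrable_indicator_iff (measurableSet_Ioc.inter measurableSet_Ioc)).2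
      (integrableOn_const (ne_of_lt ?_))
    exact (measure_mono Set.inter_subset_left).trans_lt
      ((Measure.restrict_apply_le _ _).trans_lt measure_Ioc_lt_top)
  simp_rw [h]
  rw [integral_finsetSum _ fun j _ ↦ integrable_finsetSum _ fun k _ ↦ hint j k]
  refine Finset.sum_congr rfl fun j _ ↦ ?_
  rw [integral_finsetSum _ fun k _ ↦ hint j k]
  refine Finset.sum_congr rfl fun k _ ↦ ?_
  rw [integral_indicator_const _ (measurableSet_Ioc.inter measurableSet_Ioc),
    measureReal_Ioc_inter_Ioc (φ.le j) (φ.le k), smul_eq_mul, mul_comm]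

lemma hasGaussianLaw_integral (φ : StepData) (hB : IsPreBrownianReal B P) :
    HasGaussianLaw (φ.integral B) P := by
  classical
  -- A linear image of finitely many values of `B`, treated as a Gaussian process with a one-point
  -- index set.
  have : IsGaussianProcess (fun (_ : Unit) ↦ φ.integral B) P :=
    hB.isGaussianProcess.of_isGaussianProcess fun _ ↦
      ⟨Finset.univ.image φ.left ∪ Finset.univ.image φ.right,
      { toFun x := ∑ k, φ.coeff k * (x ⟨φ.right k, by simp⟩ - x ⟨φ.left k, by simp⟩)
        map_add' x y := by
          simp only [Pi.add_apply, ← Finset.sum_add_distrib]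
          exact Finset.sum_congr rfl fun k _ ↦ by ring
        map_smul' c x := by
          simp only [Pi.smul_apply, smul_eq_mul, Finset.mul_sum, RingHom.id_apply]
          exact Finset.sum_congr rfl fun k _ ↦ by ring }, fun ω ↦ rfl⟩
  exact this.hasGaussianLaw_eval ()

lemma memLp_integral (φ : StepData) (hB : IsPreBrownianReal B P) : MemLp (φ.integral B) 2 P :=
  (φ.hasGaussianLaw_integral hB).memLp_two

lemma integral_integral (φ : StepData) (hB : IsPreBrownianReal B P) : P[φ.integral B] = 0 := by
  simp only [StepData.integral]
  rw [integral_finsetSum]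
  · refine Finset.sum_eq_zero fun k _ ↦ ?_
    rw [integral_const_mul, integral_sub (hB.integrable_eval _) (hB.integrable_eval _),
      hB.integral_eval, hB.integral_eval, sub_zero, mul_zero]
  · exact fun k _ ↦ ((hB.integrable_eval _).sub (hB.integrable_eval _)).const_mul _

/-- The Itô isometry for step functions. -/
lemma variance_integral (φ : StepData) (hB : IsPreBrownianReal B P) :
    Var[φ.integral B; P] = ∫ s in Set.Ioi 0, φ.toFun s ^ 2 := by
  have := hB.isGaussianProcess.isProbabilityMeasure
  have hB2 (t : ℝ≥0) : MemLp (B t) 2 P := (hB.isGaussianProcess.hasGaussianLaw_eval t).memLp_two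
  rw [integral_sq_toFun, ← covariance_self (φ.memLp_integral hB).1.aemeasurable]
  have hm (k : Fin φ.n) :
      MemLp (fun ω ↦ φ.coeff k * (B (φ.right k) ω - B (φ.left k) ω)) 2 P :=
    ((hB2 _).sub (hB2 _)).const_mul _
  refine (covariance_fun_sum_fun_sum hm hm).trans ?_
  refine Finset.sum_congr rfl fun j _ ↦ Finset.sum_congr rfl fun k _ ↦ ?_
  rw [covariance_const_mul_left, covariance_const_mul_right,
    covariance_fun_sub_fun_sub (hB2 _) (hB2 _) (hB2 _) (hB2 _)]
  simp only [hB.covariance_eval, NNReal.coe_min]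
  ring

lemma hasLaw_integral (φ : StepData) (hB : IsPreBrownianReal B P) :
    HasLaw (φ.integral B) (gaussianReal 0 (∫ s in Set.Ioi 0, φ.toFun s ^ 2).toNNReal) P where
  aemeasurable := (φ.memLp_integral hB).1.aemeasurable
  map_eq := by
    rw [(φ.hasGaussianLaw_integral hB).map_eq_gaussianReal, φ.integral_integral hB,
      φ.variance_integral hB]

lemma eLpNorm_integral (φ : StepData) (hB : IsPreBrownianReal B P) :
    eLpNorm (φ.integral B) 2 P = eLpNorm φ.toFun 2 (volume.restrict (Set.Ioi 0)) := by
  refine eLpNorm_two_eq_of_integral_sq_eq (φ.memLp_integral hB) (φ.memLp_toFun 2) ?_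
  rw [← φ.variance_integral hB, variance_of_integral_eq_zero
    (φ.memLp_integral hB).1.aemeasurable (φ.integral_integral hB)]

/-- The linear combination `a φ + b ψ` of two step functions. -/
def linComb (a b : ℝ) (φ ψ : StepData) : StepData where
  n := φ.n + ψ.n
  coeff := Fin.append (a • φ.coeff) (b • ψ.coeff)
  left := Fin.append φ.left ψ.left
  right := Fin.append φ.right ψ.right
  le k := by
    refine Fin.addCases (fun i ↦ ?_) (fun i ↦ ?_) k
    · simpa using φ.le i
    · simpa using ψ.le i

lemma linComb_toFun (a b : ℝ) (φ ψ : StepData) (s : ℝ) :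
    (linComb a b φ ψ).toFun s = a * φ.toFun s + b * ψ.toFun s := by
  refine (Fin.sum_univ_add _).trans ?_
  simp only [toFun, linComb, Fin.append_left, Fin.append_right, Pi.smul_apply,
    smul_eq_mul, Finset.mul_sum, Set.indicator_const_mul]

lemma linComb_integral {Ω : Type*} (a b : ℝ) (φ ψ : StepData) (B : ℝ≥0 → Ω → ℝ) (ω : Ω) :
    (linComb a b φ ψ).integral B ω = a * φ.integral B ω + b * ψ.integral B ω := by
  refine (Fin.sum_univ_add _).trans ?_
  simp only [StepData.integral, linComb, Fin.append_left, Fin.append_right,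
    Pi.smul_apply, smul_eq_mul, Finset.mul_sum, mul_assoc]

lemma eLpNorm_integral_sub (φ ψ : StepData) (hB : IsPreBrownianReal B P) :
    eLpNorm (φ.integral B - ψ.integral B) 2 P =
      eLpNorm (φ.toFun - ψ.toFun) 2 (volume.restrict (Set.Ioi 0)) := by
  have h := (linComb 1 (-1) φ ψ).eLpNorm_integral hB
  convert h using 2
  · ext ω; simp [linComb_integral, sub_eq_add_neg]
  · ext s; simp [linComb_toFun, sub_eq_add_neg]

end StepData

/-! ### Linearity, law and existence of Wiener integrals. -/

namespace IsWienerIntegral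

variable {Ω : Type*} [MeasurableSpace Ω] {B : ℝ≥0 → Ω → ℝ} {P : Measure Ω} {f g : ℝ → ℝ}
  {I J : Ω → ℝ}

lemma linComb (hB : IsPreBrownianReal B P) (hf : IsWienerIntegral B P f I)
    (hg : IsWienerIntegral B P g J) (a b : ℝ) :
    IsWienerIntegral B P (fun s ↦ a * f s + b * g s) (fun ω ↦ a * I ω + b * J ω) where
  memLp_integrand := (hf.memLp_integrand.const_mul a).add (hg.memLp_integrand.const_mul b)
  memLp_integral := (hf.memLp_integral.const_mul a).add (hg.memLp_integral.const_mul b)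
  exists_approx := by
    obtain ⟨φ, hφ, hφI⟩ := hf.exists_approx
    obtain ⟨ψ, hψ, hψJ⟩ := hg.exists_approx
    refine ⟨fun n ↦ StepData.linComb a b (φ n) (ψ n), ?_, ?_⟩
    · simp only [StepData.linComb_toFun]
      exact tendsto_eLpNorm_linComb a b (fun n ↦ (φ n).memLp_toFun 2) (fun n ↦ (ψ n).memLp_toFun 2) hf.memLp_integrand
        hg.memLp_integrand hφ hψ
    · simp only [StepData.linComb_integral]
      exact tendsto_eLpNorm_linComb a b (fun n ↦ (φ n).memLp_integral hB) (fun n ↦ (ψ n).memLp_integral hB)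
        hf.memLp_integral hg.memLp_integral hφI hψJ

/-- A Wiener integral is a centred Gaussian variable; its variance is given by the Itô isometry. -/
theorem hasLaw (hB : IsPreBrownianReal B P) (hf : IsWienerIntegral B P f I) :
    HasLaw I (gaussianReal 0 (∫ s in Set.Ioi 0, f s ^ 2).toNNReal) P where
  aemeasurable := hf.memLp_integral.1.aemeasurable
  map_eq := by
    have := hB.isGaussianProcess.isProbabilityMeasure
    have := Measure.isProbabilityMeasure_map (μ := P) hf.memLp_integral.1.aemeasurable
    obtain ⟨φ, hφ, hφI⟩ := hf.exists_approx
    refine Measure.ext_of_charFun (funext fun t ↦ ?_)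
    have h1 := tendsto_charFun_map_of_tendsto_eLpNorm (fun n ↦ (φ n).memLp_integral hB)
      hf.memLp_integral hφI t
    have h2 := tendsto_integral_sq_of_tendsto_eLpNorm (fun n ↦ (φ n).memLp_toFun 2)
      hf.memLp_integrand hφ
    -- The step integrals are Gaussian with variances converging by `h2`, so their characteristic
    -- functions also tend to the Gaussian one.
    refine tendsto_nhds_unique h1 ?_
    simp only [((φ _).hasLaw_integral hB).map_eq, charFun_gaussianReal]
    refine (Complex.continuous_exp.tendsto _).comp (tendsto_const_nhds.sub
      (Tendsto.div_const (Tendsto.mul_const _ ?_) _))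
    exact (Complex.continuous_ofReal.tendsto _).comp ((NNReal.continuous_coe.tendsto _).comp
      ((continuous_real_toNNReal.tendsto _).comp h2))

lemma exists_of_approx (hB : IsPreBrownianReal B P) (hf : MemLp f 2 (volume.restrict (Set.Ioi 0)))
    {φ : ℕ → StepData} (hφ : Tendsto (fun n ↦ eLpNorm (fun s ↦ (φ n).toFun s - f s) 2
      (volume.restrict (Set.Ioi 0))) atTop (𝓝 0)) :
    ∃ I, IsWienerIntegral B P f I := by
  have hI (n : ℕ) := (φ n).memLp_integral hB
  have hF (n : ℕ) := (φ n).memLp_toFun 2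
  have h1 := ((Lp.tendsto_Lp_iff_tendsto_eLpNorm'' (fun n ↦ (φ n).toFun) hF f hf).2 hφ).cauchySeq
  -- The isometry carries the Cauchy property from the integrands to the integrals.
  have h2 : CauchySeq fun n ↦ (hI n).toLp := by
    rw [EMetric.cauchySeq_iff] at h1 ⊢
    simpa only [Lp.edist_toLp_toLp, StepData.eLpNorm_integral_sub _ _ hB] using h1
  obtain ⟨I, hlim⟩ := cauchySeq_tendsto_of_complete h2
  refine ⟨I, hf, Lp.memLp I, φ, hφ, ?_⟩
  have := (Lp.tendsto_Lp_iff_tendsto_eLpNorm'' _ hI I (Lp.memLp I)).1 (by simpa using hlim)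
  exact this

end IsWienerIntegral

/-! ### The kernel: covariances, step approximation, variance estimates. -/

section Kernel

variable {β : ℝ}

lemma interpolationKernel_of_mem {t : ℝ≥0} {s : ℝ} (hs : s ∈ Set.Ioc (0 : ℝ) t) :
    interpolationKernel β t s = ((t : ℝ) / s) ^ ((1 - β) / 2) := Set.indicator_of_mem hs _

lemma interpolationKernel_of_notMem {t : ℝ≥0} {s : ℝ} (hs : s ∉ Set.Ioc (0 : ℝ) t) :
    interpolationKernel β t s = 0 := Set.indicator_of_notMem hs _

lemma interpolationKernel_nonneg (t : ℝ≥0) (s : ℝ) : 0 ≤ interpolationKernel β t s := by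
  refine Set.indicator_nonneg (fun u hu ↦ ?_) s
  have := hu.1
  positivity

lemma measurable_interpolationKernel (t : ℝ≥0) : Measurable (interpolationKernel β t) :=
  Measurable.indicator (by fun_prop) measurableSet_Ioc

lemma interpolationKernel_mul (s t : ℝ≥0) :
    (fun u ↦ interpolationKernel β s u * interpolationKernel β t u) =
      (Set.Ioc (0 : ℝ) (min s t : ℝ≥0)).indicator
        fun u ↦ ((s : ℝ) * t) ^ ((1 - β) / 2) * u ^ (β - 1) := by
  have h : Set.Ioc (0 : ℝ) (min s t : ℝ≥0) = Set.Ioc (0 : ℝ) s ∩ Set.Ioc (0 : ℝ) t := by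
    rw [Set.Ioc_inter_Ioc]; simp
  ext u
  simp only [interpolationKernel]
  rw [← Set.inter_indicator_mul, h]
  refine congrFun (Set.indicator_congr fun v hv ↦ ?_) u
  have hv : 0 < v := hv.1.1
  rw [Real.div_rpow s.coe_nonneg hv.le, Real.div_rpow t.coe_nonneg hv.le,
    Real.mul_rpow s.coe_nonneg t.coe_nonneg,
    show β - 1 = -((1 - β) / 2) + -((1 - β) / 2) by ring, Real.rpow_add hv, Real.rpow_neg hv.le]
  field_simp

lemma integrable_interpolationKernel_mul (hβ : 0 < β) (s t : ℝ≥0) :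
    Integrable (fun u ↦ interpolationKernel β s u * interpolationKernel β t u)
      (volume.restrict (Set.Ioi 0)) := by
  rw [interpolationKernel_mul, integrable_indicator_iff measurableSet_Ioc, IntegrableOn]
  refine Integrable.const_mul (IntegrableOn.mono_measure ?_ Measure.restrict_le_self) _
  rw [← intervalIntegrable_iff_integrableOn_Ioc_of_le (min s t).coe_nonneg]
  exact intervalIntegral.intervalIntegrable_rpow' (by linarith)

lemma memLp_interpolationKernel (hβ : 0 < β) (t : ℝ≥0) :
    MemLp (interpolationKernel β t) 2 (volume.restrict (Set.Ioi 0)) := by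
  rw [memLp_two_iff_integrable_sq (measurable_interpolationKernel t).aestronglyMeasurable]
  simpa only [sq] using integrable_interpolationKernel_mul hβ t t

lemma mul_integral_interpolationKernel_mul (hβ : 0 < β) (s t : ℝ≥0) :
    β * ∫ u in Set.Ioi 0, interpolationKernel β s u * interpolationKernel β t u =
      ((s : ℝ) * t) ^ ((1 - β) / 2) * (min s t : ℝ) ^ β := by
  rw [interpolationKernel_mul, setIntegral_indicator measurableSet_Ioc, integral_const_mul,
    Set.inter_eq_right.2 fun x hx ↦ hx.1, ← intervalIntegral.integral_of_le (min s t).coe_nonneg,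
    integral_rpow (Or.inl (by linarith))]
  simp only [sub_add_cancel, Real.zero_rpow hβ.ne', sub_zero, NNReal.coe_min]
  field_simp

/-- The step function that takes, on the `k`-th of `n + 1` intervals of equal length that make up
`(0, t]`, the value of the kernel at the right end point. -/
noncomputable def interpolationStep (β : ℝ) (t : ℝ≥0) (n : ℕ) : StepData where
  n := n + 1
  coeff k := interpolationKernel β t (t * ((k + 1 : ℕ) : ℝ) / (n + 1))
  left k := t * (k : ℕ) / (n + 1)
  right k := t * (k + 1 : ℕ) / (n + 1)
  le k := by gcongr; omega

lemma interpolationStep_of_notMem {t : ℝ≥0} {s : ℝ} (hs : s ∉ Set.Ioc (0 : ℝ) t) (n : ℕ) :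
    (interpolationStep β t n).toFun s = 0 := by
  refine Finset.sum_eq_zero fun k _ ↦ Set.indicator_of_notMem (fun h ↦ hs ?_) _
  refine ⟨((interpolationStep β t n).left k).2.trans_lt h.1, h.2.trans ?_⟩
  have hk : ((k : ℕ) + 1 : ℕ) ≤ n + 1 := k.2
  have hk' : (((k : ℕ) + 1 : ℕ) : ℝ) ≤ n + 1 := by exact_mod_cast hk
  simp only [interpolationStep, NNReal.coe_div, NNReal.coe_mul, NNReal.coe_add, NNReal.coe_one,
    NNReal.coe_natCast]
  rw [div_le_iff₀ (by positivity)]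
  gcongr

/-- Sampling at the right end point `r ≥ s` of a decreasing kernel keeps the step function below the
kernel, which is the domination needed near the singularity at `0`. -/
lemma exists_interpolationStep_eq {t : ℝ≥0} {s : ℝ} (hs : s ∈ Set.Ioc (0 : ℝ) t) (n : ℕ) :
    ∃ r, s ≤ r ∧ r ≤ t ∧ r ≤ s + t / (n + 1) ∧
      (interpolationStep β t n).toFun s = interpolationKernel β t r := by
  have ht : (0 : ℝ) < t := hs.1.trans_le hs.2
  have hn : (0 : ℝ) < (n : ℝ) + 1 := by positivity
  -- The intervals are open on the left, so the index comes from a ceiling.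
  have key (k : ℕ) : s ∈ Set.Ioc ((t : ℝ) * k / (n + 1)) (t * ((k + 1 : ℕ) : ℝ) / (n + 1)) ↔
      ⌈s * (n + 1) / t⌉₊ = k + 1 := by
    rw [Nat.ceil_eq_iff (by omega), Set.mem_Ioc, div_lt_iff₀ hn, le_div_iff₀ hn, lt_div_iff₀ ht,
      div_le_iff₀ ht]
    simp only [add_tsub_cancel_right, Nat.cast_add, Nat.cast_one, mul_comm (t : ℝ)]
  have hpos : 0 < ⌈s * (n + 1) / t⌉₊ := Nat.ceil_pos.2 (div_pos (mul_pos hs.1 hn) ht)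
  have hle : ⌈s * (n + 1) / t⌉₊ ≤ n + 1 := by
    rw [Nat.ceil_le, div_le_iff₀ ht]
    push_cast
    rw [mul_comm]
    gcongr
    exact hs.2
  obtain ⟨k, hk⟩ : ∃ k, ⌈s * (n + 1) / t⌉₊ = k + 1 := ⟨_, (Nat.succ_pred_eq_of_pos hpos).symm⟩
  have hmem := (key k).2 hk
  refine ⟨t * ((k + 1 : ℕ) : ℝ) / (n + 1), hmem.2, ?_, ?_, ?_⟩
  · rw [div_le_iff₀ hn]
    gcongr
    exact_mod_cast hk ▸ hle
  · have := hmem.1.le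
    have e : (t : ℝ) * ((k + 1 : ℕ) : ℝ) / (n + 1) = t * k / (n + 1) + t / (n + 1) := by
      push_cast; ring
    rw [e]; gcongr
  · have hkn : k < n + 1 := by omega
    refine (Finset.sum_eq_single (⟨k, hkn⟩ : Fin (n + 1)) (fun j _ hj ↦ ?_)
      (fun h ↦ (h (Finset.mem_univ _)).elim)).trans ?_
    · refine Set.indicator_of_notMem (fun h ↦ hj (Fin.ext ?_)) _
      have := (key j).1 (by simpa [interpolationStep] using h)
      simp only
      omega
    · refine (Set.indicator_of_mem (by simpa [interpolationStep] using hmem) _)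

lemma interpolationKernel_antitone (hβ : β ≤ 1) {t : ℝ≥0} {s r : ℝ} (hs : 0 < s) (hsr : s ≤ r)
    (hr : r ≤ t) : interpolationKernel β t r ≤ interpolationKernel β t s := by
  rw [interpolationKernel_of_mem ⟨hs.trans_le hsr, hr⟩, interpolationKernel_of_mem ⟨hs, hsr.trans hr⟩]
  have := hs.trans_le hsr
  refine Real.rpow_le_rpow (by positivity) (by gcongr) (by linarith)

lemma abs_interpolationStep_sub_le (hβ : β ≤ 1) (t : ℝ≥0) (n : ℕ) (s : ℝ) :
    |(interpolationStep β t n).toFun s - interpolationKernel β t s| ≤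
      interpolationKernel β t s := by
  by_cases hs : s ∈ Set.Ioc (0 : ℝ) t
  · obtain ⟨r, h1, h2, -, h⟩ := exists_interpolationStep_eq (β := β) hs n
    have := interpolationKernel_antitone hβ hs.1 h1 h2
    have := interpolationKernel_nonneg (β := β) t r
    rw [h, abs_le]
    constructor <;> linarith [interpolationKernel_nonneg (β := β) t s]
  · simp [interpolationStep_of_notMem hs, interpolationKernel_of_notMem hs]

lemma tendsto_interpolationStep (t : ℝ≥0) (s : ℝ) :
    Tendsto (fun n ↦ (interpolationStep β t n).toFun s) atTop
      (𝓝 (interpolationKernel β t s)) := by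
  by_cases hs : s ∈ Set.Ioc (0 : ℝ) t
  · have ht : (0 : ℝ) < t := hs.1.trans_le hs.2
    choose r h1 h2 h3 h using exists_interpolationStep_eq (β := β) hs
    have hr : Tendsto r atTop (𝓝 s) := by
      refine tendsto_of_tendsto_of_tendsto_of_le_of_le tendsto_const_nhds ?_ h1 h3
      have : Tendsto (fun n : ℕ ↦ (t : ℝ) / ((n : ℝ) + 1)) atTop (𝓝 0) :=
        tendsto_const_div_atTop_nhds_zero_nat (t : ℝ) |>.comp (tendsto_add_atTop_nat 1) |>.congr
          fun n ↦ by simp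
      simpa using this.const_add s
    simp_rw [h, interpolationKernel_of_mem hs,
      interpolationKernel_of_mem ⟨hs.1.trans_le (h1 _), h2 _⟩]
    have := hs.1.ne'
    have hts : (t : ℝ) / s ≠ 0 := by positivity
    exact (tendsto_const_nhds.div hr this).rpow_const (Or.inl hts)
  · simp [interpolationStep_of_notMem hs, interpolationKernel_of_notMem hs]

lemma tendsto_eLpNorm_interpolationStep (hβ : β ∈ Set.Ioo (0 : ℝ) 1) (t : ℝ≥0) :
    Tendsto (fun n ↦ eLpNorm (fun s ↦ (interpolationStep β t n).toFun s - interpolationKernel β t s)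
      2 (volume.restrict (Set.Ioi 0))) atTop (𝓝 0) := by
  have hK := memLp_interpolationKernel hβ.1 t
  have hm (n : ℕ) : AEStronglyMeasurable
      (fun s ↦ (interpolationStep β t n).toFun s - interpolationKernel β t s)
      (volume.restrict (Set.Ioi 0)) := (((interpolationStep β t n).memLp_toFun 2).sub hK).1
  have hlim : Tendsto (fun n ↦ ∫⁻ s in Set.Ioi 0,
      ‖(interpolationStep β t n).toFun s - interpolationKernel β t s‖ₑ ^ (2 : ℝ)) atTop
      (𝓝 (∫⁻ s in Set.Ioi (0 : ℝ), 0)) := by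
    refine tendsto_lintegral_of_dominated_convergence'
      (fun s ↦ ‖interpolationKernel β t s‖ₑ ^ (2 : ℝ)) (fun n ↦ (hm n).enorm.pow_const _)
      (fun n ↦ ae_of_all _ fun s ↦ ?_) ?_ (ae_of_all _ fun s ↦ ?_)
    · refine ENNReal.rpow_le_rpow ?_ (by norm_num)
      rw [enorm_le_iff_norm_le, Real.norm_eq_abs, Real.norm_eq_abs]
      exact (abs_interpolationStep_sub_le hβ.2.le t n s).trans (le_abs_self _)
    · have := lintegral_rpow_enorm_lt_top_of_eLpNorm_lt_top two_ne_zero ENNReal.ofNat_ne_top hK.2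
      simpa using this.ne
    · have h := ((tendsto_interpolationStep (β := β) t s).sub_const
        (interpolationKernel β t s)).enorm.ennrpow_const 2
      simpa using h
  have h2 := hlim.ennrpow_const (1 / 2)
  rw [lintegral_zero, ENNReal.zero_rpow_of_pos (by norm_num)] at h2
  refine h2.congr fun n ↦ ?_
  rw [eLpNorm_eq_lintegral_rpow_enorm_toReal two_ne_zero ENNReal.ofNat_ne_top]
  simp

lemma isWienerIntegral_wienerIntegral {Ω : Type*} [MeasurableSpace Ω] {B : ℝ≥0 → Ω → ℝ}
    {P : Measure Ω} (hB : IsPreBrownianReal B P) (hβ : β ∈ Set.Ioo (0 : ℝ) 1) (t : ℝ≥0) :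
    IsWienerIntegral B P (interpolationKernel β t)
      (wienerIntegral B P (interpolationKernel β t)) := by
  have h := IsWienerIntegral.exists_of_approx hB (memLp_interpolationKernel hβ.1 t)
    (tendsto_eLpNorm_interpolationStep hβ t)
  rw [wienerIntegral, dif_pos h]
  exact h.choose_spec

/-- The variance of `√β (a I_s + b I_t)`, where `I_t` is the Wiener integral of the kernel. -/
lemma integral_sq_interpolationKernel_linComb (hβ : 0 < β) (a b : ℝ) (s t : ℝ≥0) :
    ∫ u in Set.Ioi 0, (a * (√β * interpolationKernel β s u)
        + b * (√β * interpolationKernel β t u)) ^ 2 =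
      a ^ 2 * s + b ^ 2 * t + 2 * a * b * (((s : ℝ) * t) ^ ((1 - β) / 2) * (min s t : ℝ) ^ β) := by
  have e (u : ℝ) : (a * (√β * interpolationKernel β s u)
        + b * (√β * interpolationKernel β t u)) ^ 2 =
      a ^ 2 * β * (interpolationKernel β s u * interpolationKernel β s u) +
      b ^ 2 * β * (interpolationKernel β t u * interpolationKernel β t u) +
      2 * a * b * β * (interpolationKernel β s u * interpolationKernel β t u) := by
    have := Real.mul_self_sqrt hβ.le
    linear_combination (a * interpolationKernel β s u + b * interpolationKernel β t u) ^ 2 * this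
  -- The variance at time `t` is `t` for every `β`; at `t = 0` this uses `0 ^ β = 0`.
  have hself (t : ℝ≥0) : ((t : ℝ) * t) ^ ((1 - β) / 2) * (min t t : ℝ) ^ β = t := by
    rcases eq_or_ne t 0 with rfl | ht
    · simp [Real.zero_rpow hβ.ne']
    · have ht : (0 : ℝ) < t := by positivity
      rw [min_self, Real.mul_rpow ht.le ht.le, ← Real.rpow_add ht, ← Real.rpow_add ht]
      ring_nf
      exact Real.rpow_one _
  have hi := integrable_interpolationKernel_mul hβ
  simp_rw [e]
  have h1 := (hi s s).const_mul (a ^ 2 * β)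
  have h2 := (hi t t).const_mul (b ^ 2 * β)
  rw [integral_add (f := fun u ↦ a ^ 2 * β * (interpolationKernel β s u * interpolationKernel β s u)
      + b ^ 2 * β * (interpolationKernel β t u * interpolationKernel β t u)) (h1.add h2)
    ((hi s t).const_mul _), integral_add h1 h2, integral_const_mul, integral_const_mul,
    integral_const_mul]
  rw [← mul_integral_interpolationKernel_mul hβ]
  have hs := hself s
  have ht := hself t
  rw [← mul_integral_interpolationKernel_mul hβ] at hs ht
  linear_combination a ^ 2 * hs + b ^ 2 * ht

/-- The right-hand side is free of `β`; all uniform estimates come from here. For `s ≤ t`, replacing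
`t` by `s` in the covariance only lowers it, and leaves `s`. -/
lemma integral_sq_interpolationKernel_sub_le (hβ : β ∈ Set.Ioo (0 : ℝ) 1) (s t : ℝ≥0) :
    ∫ u in Set.Ioi 0, (1 * (√β * interpolationKernel β s u)
        + (-1) * (√β * interpolationKernel β t u)) ^ 2 ≤ (nndist s t : ℝ) := by
  wlog hst : s ≤ t generalizing s t
  · rw [nndist_comm]
    refine le_trans (le_of_eq ?_) (this t s (le_of_not_ge hst))
    congr 1; ext u; ring
  rw [integral_sq_interpolationKernel_linComb hβ.1, coe_nndist, NNReal.dist_eq,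
    abs_of_nonpos (sub_nonpos.2 (by exact_mod_cast hst)), min_eq_left (by exact_mod_cast hst)]
  have h : (s : ℝ) ≤ ((s : ℝ) * t) ^ ((1 - β) / 2) * (s : ℝ) ^ β := by
    rcases eq_or_ne s 0 with rfl | hs
    · simp [Real.zero_rpow hβ.1.ne']
    have hs : (0 : ℝ) < s := by positivity
    calc (s : ℝ) = ((s : ℝ) * s) ^ ((1 - β) / 2) * (s : ℝ) ^ β := by
          rw [Real.mul_rpow hs.le hs.le, ← Real.rpow_add hs, ← Real.rpow_add hs]
          ring_nf
          exact (Real.rpow_one _).symm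
      _ ≤ _ := by
          gcongr
          · linarith [hβ.2]
  linarith

/-- This is the coordinate variance of `(X_t - z) - √t (X_1 - z)`. For `t > 0` it is continuous in
`β` and vanishes at `β = 0`; for `t = 0` it is identically zero. -/
lemma tendsto_interpolationKernel_variance (t : ℝ≥0) :
    Tendsto (fun β : ℝ ↦ (1 : ℝ) ^ 2 * t + (-√t) ^ 2 * (1 : ℝ≥0) + 2 * 1 * (-√t) *
      (((t : ℝ) * (1 : ℝ≥0)) ^ ((1 - β) / 2) * (min t (1 : ℝ≥0) : ℝ) ^ β)) (𝓝 0) (𝓝 0) := by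
  rcases eq_or_ne t 0 with rfl | ht
  · simp
  have ht : (0 : ℝ) < t := by positivity
  have h : ContinuousAt (fun β : ℝ ↦ (1 : ℝ) ^ 2 * t + (-√t) ^ 2 * (1 : ℝ≥0) + 2 * 1 * (-√t) *
      (((t : ℝ) * (1 : ℝ≥0)) ^ ((1 - β) / 2) * (min t (1 : ℝ≥0) : ℝ) ^ β)) 0 := by
    refine ContinuousAt.add continuousAt_const (ContinuousAt.mul continuousAt_const
      (ContinuousAt.mul ?_ ?_))
    · exact ContinuousAt.rpow continuousAt_const (by fun_prop) (Or.inl (by positivity))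
    · exact ContinuousAt.rpow continuousAt_const (by fun_prop)
        (Or.inl (lt_min ht (by simp)).ne')
  have e := h.tendsto
  convert e using 2
  simp only [sub_zero, Real.rpow_zero, mul_one, NNReal.coe_one, neg_sq, Real.sq_sqrt ht.le]
  rw [← Real.sqrt_eq_rpow]
  linarith [Real.mul_self_sqrt ht.le]

end Kernel

/-! ### Even moments of Gaussian vectors. -/

section Moments

variable {Ω : Type*} [MeasurableSpace Ω] {P : Measure Ω}

/-- The moment of order `2 m` of the standard real Gaussian law. -/
noncomputable def gaussianMoment (m : ℕ) : ℝ≥0∞ := ∫⁻ x, ‖x‖ₑ ^ (2 * m) ∂(gaussianReal 0 1)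

lemma gaussianMoment_ne_top (m : ℕ) : gaussianMoment m ≠ ∞ := by
  rcases eq_or_ne m 0 with rfl | hm
  · simp [gaussianMoment]
  have h := lintegral_rpow_enorm_lt_top_of_eLpNorm_lt_top
    (p := ((2 * m : ℕ) : ℝ≥0∞)) (by simpa using hm) (by finiteness)
    (memLp_id_gaussianReal' (μ := 0) (v := 1) ((2 * m : ℕ) : ℝ≥0∞) (by finiteness)).2
  simp only [ENNReal.toReal_natCast, ENNReal.rpow_natCast, id_eq] at h
  exact h.ne

lemma lintegral_enorm_pow_of_hasLaw_gaussianReal {X : Ω → ℝ} {v : ℝ≥0}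
    (hX : HasLaw X (gaussianReal 0 v) P) (m : ℕ) :
    ∫⁻ ω, ‖X ω‖ₑ ^ (2 * m) ∂P = v ^ m * gaussianMoment m := by
  have h : gaussianReal 0 v = (gaussianReal 0 1).map (√(v : ℝ) * ·) := by
    rw [gaussianReal_map_const_mul]
    congr 1
    · simp
    · ext; simp
  have hv : ‖√(v : ℝ)‖ₑ ^ 2 = (v : ℝ≥0∞) := by
    rw [Real.enorm_of_nonneg (Real.sqrt_nonneg _), ← ENNReal.ofReal_pow (Real.sqrt_nonneg _),
      Real.sq_sqrt v.coe_nonneg, ENNReal.ofReal_coe_nnreal]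
  rw [hX.lintegral_comp (f := fun x ↦ ‖x‖ₑ ^ (2 * m)) (by fun_prop), h,
    lintegral_map (by fun_prop) (by fun_prop)]
  simp only [enorm_mul, mul_pow]
  rw [lintegral_const_mul _ (by fun_prop), pow_mul, hv, gaussianMoment]

/-- The power mean inequality for the squares of the coordinates. -/
lemma enorm_pow_le_sum {d : ℕ} (x : EuclideanSpace ℝ (Fin d)) (m : ℕ) :
    ‖x‖ₑ ^ (2 * (m + 1)) ≤ (d : ℝ≥0∞) ^ m * ∑ i, ‖x i‖ₑ ^ (2 * (m + 1)) := by
  have h : ‖x‖₊ ^ (2 * (m + 1)) ≤ (d : ℝ≥0) ^ m * ∑ i, ‖x i‖₊ ^ (2 * (m + 1)) := by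
    rw [← NNReal.coe_le_coe]
    push_cast
    simp only [pow_mul, EuclideanSpace.norm_sq_eq]
    simpa using pow_sum_le_card_mul_sum_pow (s := Finset.univ) (f := fun i ↦ x i ^ 2)
      (fun i _ ↦ sq_nonneg _) m
  simp only [enorm_eq_nnnorm]
  exact_mod_cast h

/-- The constant in the bound of the moments of a Gaussian vector by its variances. -/
noncomputable def vectorMomentConst (d m : ℕ) : ℝ≥0∞ := (d : ℝ≥0∞) ^ m * d * gaussianMoment (m + 1)

lemma vectorMomentConst_ne_top (d m : ℕ) : vectorMomentConst d m ≠ ∞ := by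
  have := gaussianMoment_ne_top (m + 1)
  unfold vectorMomentConst
  finiteness

/-- Only the marginal laws enter, so independence of the coordinates plays no role in the moment
bounds. -/
lemma lintegral_enorm_pow_le_of_hasLaw_gaussianReal {d : ℕ} {V : Ω → EuclideanSpace ℝ (Fin d)}
    {v : Fin d → ℝ≥0} {w : ℝ≥0} (hV : ∀ i, HasLaw (fun ω ↦ V ω i) (gaussianReal 0 (v i)) P)
    (hv : ∀ i, v i ≤ w) (m : ℕ) :
    ∫⁻ ω, ‖V ω‖ₑ ^ (2 * (m + 1)) ∂P ≤ vectorMomentConst d m * w ^ (m + 1) := by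
  calc ∫⁻ ω, ‖V ω‖ₑ ^ (2 * (m + 1)) ∂P
      ≤ ∫⁻ ω, (d : ℝ≥0∞) ^ m * ∑ i, ‖V ω i‖ₑ ^ (2 * (m + 1)) ∂P :=
        lintegral_mono fun ω ↦ enorm_pow_le_sum _ _
    _ = (d : ℝ≥0∞) ^ m * ∑ i, (v i : ℝ≥0∞) ^ (m + 1) * gaussianMoment (m + 1) := by
        rw [lintegral_const_mul' _ _ (by finiteness),
          lintegral_finsetSum' _ fun i _ ↦ (hV i).aemeasurable.enorm.pow_const _]
        simp only [lintegral_enorm_pow_of_hasLaw_gaussianReal (hV _)]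
    _ ≤ (d : ℝ≥0∞) ^ m * ∑ i : Fin d, (w : ℝ≥0∞) ^ (m + 1) * gaussianMoment (m + 1) := by
        gcongr with i
        exact_mod_cast hv i
    _ = vectorMomentConst d m * w ^ (m + 1) := by
        simp only [Finset.sum_const, Finset.card_univ, Fintype.card_fin, nsmul_eq_mul,
          vectorMomentConst]
        ring

end Moments

/-! ### Joint law of the coordinate integrals. -/

section VectorLaw

variable {Ω : Type*} [MeasurableSpace Ω] {P : Measure Ω} {d : ℕ}
  {W : ℝ≥0 → Ω → EuclideanSpace ℝ (Fin d)} {f : ℝ → ℝ} {I : Fin d → Ω → ℝ}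

/-- Independence is given for the coordinate paths of `W`. It passes to step integrals, which are
measurable functionals of these paths, and the resulting factorization survives the `L²` limit. -/
lemma charFun_sum_of_isWienerIntegral [IsProbabilityMeasure P] (hW : IsBrownianMotion W P)
    (hI : ∀ i, IsWienerIntegral (fun t ω ↦ W t ω i) P f (I i)) (x : Fin d → ℝ) :
    charFun (P.map fun ω ↦ ∑ i, x i * I i ω) 1 =
      ∏ i, charFun (P.map fun ω ↦ x i * I i ω) 1 := by
  have hB (i : Fin d) := (hW.isBrownianReal i).toIsPreBrownianReal
  choose φ hφ hφI using fun i ↦ (hI i).exists_approx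
  have hm (i : Fin d) (n : ℕ) : MemLp (fun ω ↦ x i * (φ i n).integral (fun t ω ↦ W t ω i) ω) 2 P :=
    ((φ i n).memLp_integral (hB i)).const_mul _
  have hm' (i : Fin d) : MemLp (fun ω ↦ x i * I i ω) 2 P := (hI i).memLp_integral.const_mul _
  have hterm (i : Fin d) : Tendsto (fun n ↦ eLpNorm (fun ω ↦
      x i * (φ i n).integral (fun t ω ↦ W t ω i) ω - x i * I i ω) 2 P) atTop (𝓝 0) := by
    have := ENNReal.Tendsto.const_mul (hφI i) (Or.inr (enorm_ne_top (x := x i)))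
    rw [mul_zero] at this
    refine this.congr fun n ↦ ?_
    rw [← eLpNorm_const_smul]
    congr 1; ext ω; simp [mul_sub]
  have hsum : Tendsto (fun n ↦ eLpNorm (fun ω ↦
      ∑ i, x i * (φ i n).integral (fun t ω ↦ W t ω i) ω - ∑ i, x i * I i ω) 2 P)
      atTop (𝓝 0) := by
    have h := tendsto_finsetSum Finset.univ fun i _ ↦ hterm i
    rw [Finset.sum_const_zero] at h
    refine tendsto_of_tendsto_of_tendsto_of_le_of_le tendsto_const_nhds h (fun _ ↦ zero_le)
      fun n ↦ ?_
    refine le_trans (le_of_eq ?_) (eLpNorm_sum_le (fun i _ ↦ ((hm i n).sub (hm' i)).1)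
      (by norm_num))
    congr 1; ext ω; simp [Finset.sum_sub_distrib]
  have hind (n : ℕ) : charFun
      (P.map fun ω ↦ ∑ i, x i * (φ i n).integral (fun t ω ↦ W t ω i) ω) =
        ∏ i, charFun (P.map fun ω ↦ x i * (φ i n).integral (fun t ω ↦ W t ω i) ω) := by
    refine iIndepFun.charFun_map_fun_sum_eq_prod (fun i ↦ (hm i n).1.aemeasurable) ?_
    refine hW.indep.comp (fun i w ↦ x i * ∑ k, (φ i n).coeff k *
      (w ((φ i n).right k) - w ((φ i n).left k))) fun i ↦ ?_
    fun_prop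
  have h1 := tendsto_charFun_map_of_tendsto_eLpNorm
    (fun n ↦ memLp_finsetSum Finset.univ fun i _ ↦ hm i n)
    (memLp_finsetSum Finset.univ fun i _ ↦ hm' i) hsum 1
  refine tendsto_nhds_unique h1 ?_
  simp only [hind, Finset.prod_apply]
  exact tendsto_finsetProd _ fun i _ ↦
    tendsto_charFun_map_of_tendsto_eLpNorm (hm i) (hm' i) (hterm i) 1

/-- The vector of the Wiener integrals of an integrand of norm `1` with respect to the coordinates
of a Brownian motion is a standard Gaussian vector. -/
theorem hasLaw_stdGaussian_of_isWienerIntegral [IsProbabilityMeasure P] (hW : IsBrownianMotion W P)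
    (hI : ∀ i, IsWienerIntegral (fun t ω ↦ W t ω i) P f (I i))
    (hf : ∫ s in Set.Ioi 0, f s ^ 2 = 1) :
    HasLaw (fun ω ↦ WithLp.toLp 2 fun i ↦ I i ω) (stdGaussian (EuclideanSpace ℝ (Fin d))) P := by
  have hm : AEMeasurable (fun ω ↦ (WithLp.toLp 2 fun i ↦ I i ω : EuclideanSpace ℝ (Fin d))) P :=
    (WithLp.measurable_toLp 2 _).comp_aemeasurable
      (aemeasurable_pi_lambda _ fun i ↦ (hI i).memLp_integral.1.aemeasurable)
  refine ⟨hm, ?_⟩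
  have := Measure.isProbabilityMeasure_map hm
  refine Measure.ext_of_charFun (funext fun x ↦ ?_)
  have hlaw (i : Fin d) := gaussianReal_const_mul
    ((hI i).hasLaw (hW.isBrownianReal i).toIsPreBrownianReal) (x i)
  have hsum : AEMeasurable (fun ω ↦ ∑ i, x i * I i ω) P :=
    Finset.aemeasurable_fun_sum _ fun i _ ↦ (hlaw i).aemeasurable
  -- Cramér–Wold: the vector's characteristic function at `x` is that of its scalar product with `x`
  -- at `1`.
  have e : charFun (P.map fun ω ↦ (WithLp.toLp 2 fun i ↦ I i ω : EuclideanSpace ℝ (Fin d))) x =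
      charFun (P.map fun ω ↦ ∑ i, x i * I i ω) 1 := by
    rw [charFun_apply, charFun_apply, integral_map hm (by fun_prop),
      integral_map hsum (by fun_prop)]
    simp [PiLp.inner_apply]
  rw [e, charFun_sum_of_isWienerIntegral hW hI, charFun_stdGaussian]
  simp only [(hlaw _).map_eq, charFun_gaussianReal, hf]
  have hx : (‖x‖ : ℂ) ^ 2 = ∑ i, (x i : ℂ) ^ 2 := by
    exact_mod_cast EuclideanSpace.real_norm_sq_eq x
  rw [← Complex.exp_sum, hx]
  simp [Finset.sum_div, neg_div]

end VectorLaw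

/-! ### Deterministic dyadic chaining. -/

section Chaining

/-- The dyadic point `k / 2ⁿ`. -/
noncomputable def dyadicPoint (n k : ℕ) : ℝ≥0 := k / 2 ^ n

/-- The largest multiple of `2⁻ⁿ` that is at most `t`. -/
noncomputable def dyadicFloor (n : ℕ) (t : ℝ≥0) : ℝ≥0 := dyadicPoint n ⌊2 ^ n * t⌋₊

lemma dyadicPoint_succ (n k : ℕ) : dyadicPoint (n + 1) (2 * k) = dyadicPoint n k := by
  simp only [dyadicPoint, pow_succ]; push_cast; field_simp

lemma dyadicFloor_le (n : ℕ) (t : ℝ≥0) : dyadicFloor n t ≤ t := by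
  rw [dyadicFloor, dyadicPoint, div_le_iff₀ (by positivity), mul_comm]
  exact Nat.floor_le zero_le

lemma le_dyadicFloor_add (n : ℕ) (t : ℝ≥0) : t ≤ dyadicFloor n t + (1 / 2) ^ n := by
  rw [dyadicFloor, dyadicPoint, one_div, inv_pow, ← one_div, ← add_div, le_div_iff₀ (by positivity),
    mul_comm]
  exact (Nat.lt_floor_add_one _).le

lemma nndist_dyadicFloor_le (n : ℕ) (t : ℝ≥0) : nndist (dyadicFloor n t) t ≤ (1 / 2) ^ n := by
  rw [← NNReal.coe_le_coe, coe_nndist, NNReal.dist_eq, abs_sub_comm, abs_of_nonneg]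
  · have := le_dyadicFloor_add n t
    rw [sub_le_iff_le_add']
    exact_mod_cast this
  · exact sub_nonneg.2 (by exact_mod_cast dyadicFloor_le n t)

lemma tendsto_dyadicFloor (t : ℝ≥0) : Tendsto (fun n ↦ dyadicFloor n t) atTop (𝓝 t) := by
  rw [tendsto_iff_dist_tendsto_zero]
  refine squeeze_zero (fun _ ↦ dist_nonneg) (fun n ↦ ?_)
    (tendsto_pow_atTop_nhds_zero_of_lt_one (r := (1 / 2 : ℝ)) (by norm_num) (by norm_num))
  have := nndist_dyadicFloor_le n t
  rw [← NNReal.coe_le_coe] at this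
  simpa using this

lemma nndist_dyadicPoint (n k : ℕ) :
    nndist (dyadicPoint n k) (dyadicPoint n (k + 1)) = (1 / 2) ^ n := by
  rw [← NNReal.coe_inj, coe_nndist, NNReal.dist_eq, abs_sub_comm, abs_of_nonneg]
  · simp only [dyadicPoint]; push_cast; rw [one_div, inv_pow]; ring
  · rw [sub_nonneg]; simp only [dyadicPoint]; push_cast; gcongr; simp

variable {E : Type*} [NormedAddCommGroup E] {f g : ℝ≥0 → E} {K a : ℝ} {N : ℕ}

/-- The floors of `t` at levels `n` and `n + 1` coincide or are neighbours on the finer grid. -/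
lemma dist_dyadicFloor_succ_le (hK : 0 ≤ K) (ha : 0 ≤ a)
    (hf : ∀ n k, k < N * 2 ^ n → ‖f (dyadicPoint n (k + 1)) - f (dyadicPoint n k)‖ ≤ K * a ^ n)
    {t : ℝ≥0} (ht : t ≤ N) (n : ℕ) :
    dist (f (dyadicFloor n t)) (f (dyadicFloor (n + 1) t)) ≤ K * a ^ (n + 1) := by
  set j := ⌊2 ^ n * t⌋₊ with hj
  set j' := ⌊2 ^ (n + 1) * t⌋₊ with hj'
  have h1 : (j : ℝ≥0) ≤ 2 ^ n * t := Nat.floor_le zero_le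
  have h2 : 2 ^ n * t < j + 1 := Nat.lt_floor_add_one _
  have h3 : (2 ^ (n + 1) * t : ℝ≥0) = 2 * (2 ^ n * t) := by ring
  have h4 : 2 * j ≤ j' := by
    rw [hj']; refine Nat.le_floor ?_
    rw [h3]; push_cast; gcongr
  have h5 : j' < 2 * j + 2 := by
    rw [hj', Nat.floor_lt zero_le, h3]
    push_cast
    calc 2 * (2 ^ n * t) < 2 * ((j : ℝ≥0) + 1) := by gcongr
      _ = _ := by ring
  rw [dyadicFloor, dyadicFloor, ← hj, ← hj', ← dyadicPoint_succ, dist_comm, dist_eq_norm]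
  obtain h | h : j' = 2 * j ∨ j' = 2 * j + 1 := by omega
  · rw [h, sub_self, norm_zero]; positivity
  · rw [h]
    refine hf _ _ ?_
    have : (j' : ℝ≥0) ≤ (N * 2 ^ (n + 1) : ℕ) := by
      refine (Nat.floor_le zero_le).trans ?_
      push_cast; rw [mul_comm]; gcongr
    have : j' ≤ N * 2 ^ (n + 1) := by exact_mod_cast this
    omega

lemma dist_dyadicFloor_le (hK : 0 ≤ K) (ha : 0 ≤ a)
    (hf : ∀ n k, k < N * 2 ^ n → ‖f (dyadicPoint n (k + 1)) - f (dyadicPoint n k)‖ ≤ K * a ^ n)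
    {s t : ℝ≥0} (hst : s ≤ t) (ht : t ≤ N) {n : ℕ} (h : t ≤ s + (1 / 2) ^ n) :
    dist (f (dyadicFloor n t)) (f (dyadicFloor n s)) ≤ K * a ^ n := by
  set j := ⌊2 ^ n * s⌋₊ with hj
  set j' := ⌊2 ^ n * t⌋₊ with hj'
  have h2 : 2 ^ n * s < j + 1 := Nat.lt_floor_add_one _
  have h4 : j ≤ j' := Nat.floor_mono (by gcongr)
  have h5 : j' < j + 2 := by
    rw [hj', Nat.floor_lt zero_le]
    push_cast
    calc 2 ^ n * t ≤ 2 ^ n * (s + (1 / 2) ^ n) := by gcongr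
      _ = 2 ^ n * s + 1 := by rw [mul_add, ← mul_pow]; norm_num
      _ < (j + 1) + 1 := by gcongr
      _ = _ := by ring
  rw [dyadicFloor, dyadicFloor, ← hj, ← hj', dist_eq_norm]
  obtain h | h : j' = j ∨ j' = j + 1 := by omega
  · rw [h, sub_self, norm_zero]; positivity
  · rw [h]
    refine hf _ _ ?_
    have : (j' : ℝ≥0) ≤ (N * 2 ^ n : ℕ) := by
      refine (Nat.floor_le zero_le).trans ?_
      push_cast; rw [mul_comm]; gcongr
    have : j' ≤ N * 2 ^ n := by exact_mod_cast this
    omega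

lemma cauchySeq_dyadicFloor (hK : 0 ≤ K) (ha : 0 ≤ a) (ha1 : a < 1)
    (hf : ∀ n k, k < N * 2 ^ n → ‖f (dyadicPoint n (k + 1)) - f (dyadicPoint n k)‖ ≤ K * a ^ n)
    {t : ℝ≥0} (ht : t ≤ N) : CauchySeq fun n ↦ f (dyadicFloor n t) :=
  cauchySeq_of_le_geometric a (K * a) ha1 fun n ↦
    (dist_dyadicFloor_succ_le hK ha hf ht n).trans_eq (by ring)

lemma dist_dyadicFloor_lim_le (hK : 0 ≤ K) (ha : 0 ≤ a) (ha1 : a < 1)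
    (hf : ∀ n k, k < N * 2 ^ n → ‖f (dyadicPoint n (k + 1)) - f (dyadicPoint n k)‖ ≤ K * a ^ n)
    {t : ℝ≥0} (ht : t ≤ N) (hg : Tendsto (fun n ↦ f (dyadicFloor n t)) atTop (𝓝 (g t))) (n : ℕ) :
    dist (f (dyadicFloor n t)) (g t) ≤ K / (1 - a) * a ^ n := by
  refine (dist_le_of_le_geometric_of_tendsto a K ha1 (fun n ↦
    (dist_dyadicFloor_succ_le hK ha hf ht n).trans ?_) hg n).trans_eq (by ring)
  gcongr 1
  exact pow_le_pow_of_le_one ha ha1.le (Nat.le_succ n)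

/-- Two geometric tails and one step at level `n` give `1 + 2 / (1 - a)`. The limit `g` is kept
apart from `f` because `f` may be a raw path, not yet known to be continuous. -/
lemma dist_lim_le (hK : 0 ≤ K) (ha : 0 ≤ a) (ha1 : a < 1)
    (hf : ∀ n k, k < N * 2 ^ n → ‖f (dyadicPoint n (k + 1)) - f (dyadicPoint n k)‖ ≤ K * a ^ n)
    (hg : ∀ t : ℝ≥0, t ≤ N → Tendsto (fun n ↦ f (dyadicFloor n t)) atTop (𝓝 (g t)))
    {s t : ℝ≥0} (hs : s ≤ N) (ht : t ≤ N) {n : ℕ} (h : nndist s t ≤ (1 / 2) ^ n) :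
    dist (g s) (g t) ≤ K * (1 + 2 / (1 - a)) * a ^ n := by
  wlog hst : s ≤ t generalizing s t
  · rw [dist_comm]
    exact this ht hs (by rwa [nndist_comm]) (le_of_not_ge hst)
  have hst' : t ≤ s + (1 / 2) ^ n := by
    rw [← NNReal.coe_le_coe, coe_nndist, NNReal.dist_eq, abs_sub_comm, abs_of_nonneg
      (sub_nonneg.2 (by exact_mod_cast hst)), sub_le_iff_le_add'] at h
    exact_mod_cast h
  have h1 := dist_dyadicFloor_lim_le hK ha ha1 hf hs (hg s hs) n
  have h2 := dist_dyadicFloor_lim_le hK ha ha1 hf ht (hg t ht) n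
  have h3 := dist_dyadicFloor_le hK ha hf hst ht hst'
  calc dist (g s) (g t) ≤ dist (f (dyadicFloor n s)) (g s) +
        dist (f (dyadicFloor n t)) (f (dyadicFloor n s)) + dist (f (dyadicFloor n t)) (g t) := by
        have := dist_triangle4 (g s) (f (dyadicFloor n s)) (f (dyadicFloor n t)) (g t)
        rw [dist_comm (g s) (f _), dist_comm (f (dyadicFloor n s)) (f (dyadicFloor n t))] at this
        exact this
    _ ≤ K / (1 - a) * a ^ n + K * a ^ n + K / (1 - a) * a ^ n := by gcongr
    _ = _ := by ring

/-- The exponent of Hölder continuity that moments of order `2 (m + 2)` give. -/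
noncomputable def holderExponent (m : ℕ) : ℝ := m / (2 * (m + 2))

lemma holderExponent_nonneg (m : ℕ) : 0 ≤ holderExponent m := by
  unfold holderExponent; positivity

/-- The gap `1/2 - m / (2 (m + 2))` equals `1 / (m + 2)`. -/
lemma exists_lt_holderExponent {γ : ℝ} (h : γ < 1 / 2) : ∃ m : ℕ, 1 ≤ m ∧ γ ≤ holderExponent m := by
  obtain ⟨m, hm⟩ := exists_nat_gt (max 1 (1 / (1 / 2 - γ)))
  have h1 : (1 : ℝ) < m := (le_max_left _ _).trans_lt hm
  refine ⟨m, by exact_mod_cast h1.le, ?_⟩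
  have h2 := (le_max_right _ _).trans_lt hm
  rw [div_lt_iff₀ (by linarith)] at h2
  rw [holderExponent, le_div_iff₀ (by positivity)]
  nlinarith

/-- The factor `2^(-γ)`, with `γ` the Hölder exponent. -/
noncomputable def dyadicRatio (m : ℕ) : ℝ := (1 / 2) ^ holderExponent m

lemma dyadicRatio_nonneg (m : ℕ) : 0 ≤ dyadicRatio m := by
  unfold dyadicRatio; positivity

lemma dyadicRatio_lt_one {m : ℕ} (hm : 1 ≤ m) : dyadicRatio m < 1 := by
  refine Real.rpow_lt_one (by norm_num) (by norm_num) ?_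
  have : (0 : ℝ) < m := by exact_mod_cast hm
  unfold holderExponent; positivity

lemma dyadicRatio_pow (m : ℕ) : dyadicRatio m ^ (2 * (m + 2)) = (1 / 2) ^ m := by
  rw [dyadicRatio, ← Real.rpow_natCast, ← Real.rpow_mul (by norm_num), ← Real.rpow_natCast]
  congr 1
  rw [holderExponent]; push_cast; field_simp

/-- The sum over all dyadic increments in `[0, N]` whose expectation is controlled by the moments of
order `2 (m + 2)` of the increments, and which controls the Hölder norm. -/
noncomputable def dyadicSum (m N : ℕ) (f : ℝ≥0 → E) : ℝ≥0∞ :=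
  ∑' n, ∑ k ∈ Finset.range (N * 2 ^ n),
    2 ^ (m * n) * ‖f (dyadicPoint n (k + 1)) - f (dyadicPoint n k)‖ₑ ^ (2 * (m + 2))

/-- Each term is at most the whole sum, and the weight `2 ^ (m * n)` is exactly the inverse of
`dyadicRatio m ^ n` raised to the power `2 (m + 2)`. -/
lemma norm_sub_le_of_dyadicSum_le {m : ℕ} (hK : 0 ≤ K)
    (h : dyadicSum m N f ≤ ENNReal.ofReal K ^ (2 * (m + 2))) (n k : ℕ) (hk : k < N * 2 ^ n) :
    ‖f (dyadicPoint n (k + 1)) - f (dyadicPoint n k)‖ ≤ K * dyadicRatio m ^ n := by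
  have h1 : 2 ^ (m * n) * ‖f (dyadicPoint n (k + 1)) - f (dyadicPoint n k)‖ₑ ^ (2 * (m + 2)) ≤
      ENNReal.ofReal K ^ (2 * (m + 2)) :=
    (Finset.single_le_sum (f := fun k ↦ 2 ^ (m * n) *
      ‖f (dyadicPoint n (k + 1)) - f (dyadicPoint n k)‖ₑ ^ (2 * (m + 2)))
      (fun _ _ ↦ zero_le) (Finset.mem_range.2 hk)).trans ((ENNReal.le_tsum n).trans h)
  rw [← ofReal_norm, ← ENNReal.ofReal_pow (norm_nonneg _), ← ENNReal.ofReal_pow hK,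
    ← ENNReal.ofReal_ofNat, ← ENNReal.ofReal_pow (by norm_num), ← ENNReal.ofReal_mul (by positivity),
    ENNReal.ofReal_le_ofReal_iff (by positivity)] at h1
  have hr := dyadicRatio_nonneg m
  refine (pow_le_pow_iff_left₀ (norm_nonneg _) (by positivity)
    (show 2 * (m + 2) ≠ 0 by omega)).1 ?_
  rw [mul_pow, ← pow_mul, mul_comm n, pow_mul (dyadicRatio m), dyadicRatio_pow, ← pow_mul, one_div, inv_pow,
    ← div_eq_mul_inv, le_div_iff₀ (by positivity), mul_comm]
  exact h1

lemma exists_dyadicSum_le {m : ℕ} (h : dyadicSum m N f ≠ ∞) :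
    ∃ K : ℝ, 0 ≤ K ∧ dyadicSum m N f ≤ ENNReal.ofReal K ^ (2 * (m + 2)) := by
  refine ⟨(dyadicSum m N f).toReal ^ ((2 * (m + 2) : ℕ) : ℝ)⁻¹, by positivity, ?_⟩
  rw [← ENNReal.ofReal_pow (by positivity), Real.rpow_inv_natCast_pow ENNReal.toReal_nonneg
    (by omega), ENNReal.ofReal_toReal h]

/-- A path that is continuous and has a finite dyadic sum is locally Hölder continuous. -/
lemma exists_dist_le_of_dyadicSum_ne_top {m : ℕ} (hm : 1 ≤ m) (hf : Continuous f)
    (h : dyadicSum m N f ≠ ∞) : ∃ C : ℝ, 0 ≤ C ∧ ∀ s t : ℝ≥0, s ≤ N → t ≤ N → dist s t ≤ 1 →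
      dist (f s) (f t) ≤ C * dist s t ^ holderExponent m := by
  obtain ⟨K, hK, hKf⟩ := exists_dyadicSum_le h
  have ha := dyadicRatio_nonneg m
  have ha1 := dyadicRatio_lt_one hm
  have hC : 0 ≤ K * (1 + 2 / (1 - dyadicRatio m)) := by
    have : 0 < 1 - dyadicRatio m := by linarith
    positivity
  refine ⟨K * (1 + 2 / (1 - dyadicRatio m)) * 2 ^ holderExponent m, by positivity,
    fun s t hs ht hst ↦ ?_⟩
  rcases eq_or_ne s t with rfl | hne
  · rw [dist_self]; positivity
  -- The level with `2^-(n+1) < |s - t| ≤ 2^-n`; the lower bound costs the factor `2 ^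
  -- holderExponent m`.
  obtain ⟨n, hn1, hn2⟩ := exists_nat_pow_near_of_lt_one (dist_pos.2 hne) hst
    (show (0 : ℝ) < 1 / 2 by norm_num) (by norm_num)
  have hd := dist_lim_le hK ha ha1 (norm_sub_le_of_dyadicSum_le hK hKf)
    (fun t _ ↦ (hf.tendsto t).comp (tendsto_dyadicFloor t)) hs ht (n := n)
    (by rw [← NNReal.coe_le_coe]; simpa using hn2)
  refine hd.trans ?_
  rw [mul_assoc _ (2 ^ holderExponent m)]
  gcongr
  rw [← Real.mul_rpow (by norm_num) dist_nonneg, dyadicRatio, ← Real.rpow_natCast,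
    ← Real.rpow_mul (by norm_num), mul_comm, Real.rpow_mul (by norm_num), Real.rpow_natCast]
  refine Real.rpow_le_rpow (by positivity) ?_ (holderExponent_nonneg m)
  rw [pow_succ] at hn1
  linarith

/-- A path that is continuous and has finite dyadic sums is Hölder continuous on compact intervals,
of all orders up to the one that belongs to the sums. -/
lemma exists_holderOnWith_of_dyadicSum_ne_top {m : ℕ} (hm : 1 ≤ m) (hf : Continuous f)
    (h : ∀ N, dyadicSum m N f ≠ ∞) {γ : ℝ≥0} (hγ : (γ : ℝ) ≤ holderExponent m) (T : ℝ≥0) :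
    ∃ C : ℝ≥0, HolderOnWith C γ f (Set.Icc 0 T) := by
  obtain ⟨N, hN⟩ := exists_nat_ge T
  obtain ⟨C, hC, hCf⟩ := exists_dist_le_of_dyadicSum_ne_top hm hf (h N)
  obtain ⟨D, hD⟩ := (isCompact_Icc (a := (0 : ℝ≥0)) (b := T)).exists_bound_of_continuousOn
    hf.continuousOn
  have hD0 : 0 ≤ D := (norm_nonneg _).trans (hD 0 ⟨le_rfl, zero_le⟩)
  -- `C` serves distances up to `1`; beyond that, boundedness by `D` suffices.
  refine ⟨(max C (D + D)).toNNReal, fun s hs t ht ↦ ?_⟩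
  have key : dist (f s) (f t) ≤ max C (D + D) * dist s t ^ (γ : ℝ) := by
    rcases le_total (dist s t) 1 with h1 | h1
    · calc dist (f s) (f t) ≤ C * dist s t ^ holderExponent m :=
            hCf s t (hs.2.trans hN) (ht.2.trans hN) h1
        _ ≤ max C (D + D) * dist s t ^ (γ : ℝ) := by
            gcongr ?_ * ?_
            · exact le_max_left _ _
            rcases eq_or_ne s t with rfl | hne
            · rcases eq_or_ne (γ : ℝ) 0 with h0 | h0
              · rw [h0, Real.rpow_zero]
                exact Real.rpow_le_one dist_nonneg h1 (holderExponent_nonneg m)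
              · have : 0 < (γ : ℝ) := lt_of_le_of_ne γ.2 h0.symm
                rw [dist_self, Real.zero_rpow h0, Real.zero_rpow (this.trans_le hγ).ne']
            · exact Real.rpow_le_rpow_of_exponent_ge (dist_pos.2 hne) h1 hγ
    · calc dist (f s) (f t) ≤ D + D :=
            (dist_le_norm_add_norm _ _).trans (add_le_add (hD s hs) (hD t ht))
        _ ≤ max C (D + D) * 1 := by rw [mul_one]; exact le_max_right _ _
        _ ≤ max C (D + D) * dist s t ^ (γ : ℝ) := by
            gcongr
            exact Real.one_le_rpow h1 γ.2
  rw [edist_nndist, edist_nndist, ← ENNReal.coe_rpow_of_nonneg _ γ.coe_nonneg, ← ENNReal.coe_mul,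
    ENNReal.coe_le_coe, ← NNReal.coe_le_coe]
  push_cast
  rw [Real.coe_toNNReal _ (by positivity)]
  exact key

end Chaining

/-! ### Kolmogorov's theorem and uniform convergence in probability. -/

section Kolmogorov

variable {Ω : Type*} [MeasurableSpace Ω] {P : Measure Ω} {E : Type*} [NormedAddCommGroup E]
  {X : ℝ≥0 → Ω → E} {m : ℕ} {C : ℝ≥0∞}

lemma aemeasurable_dyadicSum (hX : ∀ t, AEStronglyMeasurable (X t) P) (m N : ℕ) :
    AEMeasurable (fun ω ↦ dyadicSum m N (X · ω)) P := by
  refine AEMeasurable.tsum fun n ↦ Finset.aemeasurable_fun_sum _ fun k _ ↦ ?_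
  exact (((hX _).sub (hX _)).enorm.pow_const _).const_mul _

/-- Level `n` has `N 2^n` increments, each of moment at most `C 2^(-n(m+2))`; with the weight
`2^(mn)` it contributes at most `N C 2^-n`. -/
lemma lintegral_dyadicSum_le (hX : ∀ t, AEStronglyMeasurable (X t) P)
    (h : ∀ s t, ∫⁻ ω, ‖X t ω - X s ω‖ₑ ^ (2 * (m + 2)) ∂P ≤ C * (nndist s t : ℝ≥0∞) ^ (m + 2))
    (N : ℕ) : ∫⁻ ω, dyadicSum m N (X · ω) ∂P ≤ N * C * 2 := by
  have hmeas (n k : ℕ) : AEMeasurable (fun ω ↦ 2 ^ (m * n) *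
      ‖X (dyadicPoint n (k + 1)) ω - X (dyadicPoint n k) ω‖ₑ ^ (2 * (m + 2))) P :=
    (((hX _).sub (hX _)).enorm.pow_const _).const_mul _
  have hpow (n : ℕ) : (2 : ℝ≥0∞) ^ n * (2⁻¹ : ℝ≥0∞) ^ n = 1 := by
    rw [← mul_pow, ENNReal.mul_inv_cancel two_ne_zero ENNReal.ofNat_ne_top, one_pow]
  simp only [dyadicSum]
  rw [lintegral_tsum fun n ↦ Finset.aemeasurable_fun_sum _ fun k _ ↦ hmeas n k]
  calc ∑' n, ∫⁻ ω, ∑ k ∈ Finset.range (N * 2 ^ n), 2 ^ (m * n) *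
        ‖X (dyadicPoint n (k + 1)) ω - X (dyadicPoint n k) ω‖ₑ ^ (2 * (m + 2)) ∂P
      ≤ ∑' n, N * C * (2⁻¹ : ℝ≥0∞) ^ n := by
        refine ENNReal.tsum_le_tsum fun n ↦ ?_
        rw [lintegral_finsetSum' _ fun k _ ↦ hmeas n k]
        calc ∑ k ∈ Finset.range (N * 2 ^ n), ∫⁻ ω, 2 ^ (m * n) *
              ‖X (dyadicPoint n (k + 1)) ω - X (dyadicPoint n k) ω‖ₑ ^ (2 * (m + 2)) ∂P
            ≤ ∑ k ∈ Finset.range (N * 2 ^ n),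
                2 ^ (m * n) * (C * ((2⁻¹ : ℝ≥0∞) ^ n) ^ (m + 2)) := by
              refine Finset.sum_le_sum fun k _ ↦ ?_
              rw [lintegral_const_mul' _ _ (by finiteness)]
              gcongr
              refine (h _ _).trans_eq ?_
              rw [nndist_dyadicPoint]
              simp [ENNReal.inv_pow]
          _ = N * C * (2⁻¹ : ℝ≥0∞) ^ n := by
              rw [Finset.sum_const, Finset.card_range, nsmul_eq_mul]
              push_cast
              have e : (N * 2 ^ n : ℝ≥0∞) * (2 ^ (m * n) * (C * ((2⁻¹ : ℝ≥0∞) ^ n) ^ (m + 2))) =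
                  N * C * (2⁻¹ : ℝ≥0∞) ^ n * (2 ^ n * (2⁻¹ : ℝ≥0∞) ^ n) *
                    (2 ^ (m * n) * (2⁻¹ : ℝ≥0∞) ^ (m * n)) := by ring
              rw [e, hpow, hpow, mul_one, mul_one]
    _ = N * C * 2 := by rw [ENNReal.tsum_mul_left, ENNReal.tsum_geometric_two]

lemma ae_dyadicSum_ne_top (hX : ∀ t, AEStronglyMeasurable (X t) P) (hC : C ≠ ∞)
    (h : ∀ s t, ∫⁻ ω, ‖X t ω - X s ω‖ₑ ^ (2 * (m + 2)) ∂P ≤ C * (nndist s t : ℝ≥0∞) ^ (m + 2)) :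
    ∀ᵐ ω ∂P, ∀ N, dyadicSum m N (X · ω) ≠ ∞ := by
  refine ae_all_iff.2 fun N ↦ ?_
  have h1 := (lintegral_dyadicSum_le hX h N).trans_lt (by finiteness)
  filter_upwards [ae_lt_top' (aemeasurable_dyadicSum hX m N) h1.ne] with ω hω using hω.ne

lemma tendstoInMeasure_of_lintegral_le (hX : ∀ t, AEStronglyMeasurable (X t) P) (hC : C ≠ ∞)
    (h : ∀ s t, ∫⁻ ω, ‖X t ω - X s ω‖ₑ ^ (2 * (m + 2)) ∂P ≤ C * (nndist s t : ℝ≥0∞) ^ (m + 2))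
    {u : ℕ → ℝ≥0} {t : ℝ≥0} (hu : Tendsto u atTop (𝓝 t)) :
    TendstoInMeasure P (fun n ↦ X (u n)) atTop (X t) := by
  refine tendstoInMeasure_of_tendsto_eLpNorm (p := ((2 * (m + 2) : ℕ) : ℝ≥0∞))
    (by simp) (fun n ↦ hX _) (hX t) ?_
  have hd : Tendsto (fun n ↦ (nndist t (u n) : ℝ≥0∞)) atTop (𝓝 0) := by
    have h0 := (tendsto_const_nhds (x := t)).nndist hu
    rw [nndist_self] at h0
    have h1 := ENNReal.tendsto_coe.2 h0
    rwa [ENNReal.coe_zero] at h1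
  have hlim : Tendsto (fun n ↦ (C * (nndist t (u n) : ℝ≥0∞) ^ (m + 2)) ^
      (1 / ((2 * (m + 2) : ℕ) : ℝ))) atTop (𝓝 0) := by
    have h2 := (ENNReal.Tendsto.const_mul (ENNReal.Tendsto.pow (n := m + 2) hd) (Or.inr hC)).ennrpow_const
      (1 / ((2 * (m + 2) : ℕ) : ℝ))
    rwa [zero_pow (by omega), mul_zero, ENNReal.zero_rpow_of_pos (by positivity)] at h2
  refine tendsto_of_tendsto_of_tendsto_of_le_of_le tendsto_const_nhds hlim
    (fun _ ↦ zero_le) fun n ↦ ?_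
  rw [eLpNorm_eq_lintegral_rpow_enorm_toReal (by simp) (by finiteness)]
  simp only [ENNReal.toReal_natCast, ENNReal.rpow_natCast]
  exact ENNReal.rpow_le_rpow (h _ _) (by positivity)

/-- The **Kolmogorov continuity theorem**, for moments of even order. -/
theorem exists_isContinuousVersion [CompleteSpace E] [IsFiniteMeasure P] (hm : 1 ≤ m)
    (hX : ∀ t, AEStronglyMeasurable (X t) P) (hC : C ≠ ∞)
    (h : ∀ s t, ∫⁻ ω, ‖X t ω - X s ω‖ₑ ^ (2 * (m + 2)) ∂P ≤ C * (nndist s t : ℝ≥0∞) ^ (m + 2)) :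
    ∃ Y : Ω → C(ℝ≥0, E), IsContinuousVersion X P Y := by
  have ha := dyadicRatio_nonneg m
  have ha1 := dyadicRatio_lt_one hm
  have hpath (ω : Ω) (hω : ∀ N, dyadicSum m N (X · ω) ≠ ∞) :
      ∃ g : C(ℝ≥0, E), ∀ t, Tendsto (fun n ↦ X (dyadicFloor n t) ω) atTop (𝓝 (g t)) := by
    choose K hK hKf using fun N ↦ exists_dyadicSum_le (hω N)
    have hstep (N : ℕ) := norm_sub_le_of_dyadicSum_le (hK N) (hKf N)
    have hlim (t : ℝ≥0) : ∃ x, Tendsto (fun n ↦ X (dyadicFloor n t) ω) atTop (𝓝 x) := by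
      obtain ⟨N, hN⟩ := exists_nat_ge t
      exact cauchySeq_tendsto_of_complete (cauchySeq_dyadicFloor (f := (X · ω)) (hK N) ha ha1 (hstep N) hN)
    choose g hg using hlim
    refine ⟨⟨g, ?_⟩, hg⟩
    rw [continuous_iff_continuousAt]
    intro t
    obtain ⟨N, hN⟩ := exists_nat_gt t
    rw [Metric.continuousAt_iff']
    intro ε hε
    have hpow : Tendsto (fun n ↦ K N * (1 + 2 / (1 - dyadicRatio m)) * dyadicRatio m ^ n) atTop
        (𝓝 0) := by
      simpa using (tendsto_pow_atTop_nhds_zero_of_lt_one ha ha1).const_mul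
        (K N * (1 + 2 / (1 - dyadicRatio m)))
    obtain ⟨n, hn⟩ := (hpow.eventually_lt_const hε).exists
    filter_upwards [eventually_lt_nhds hN, Metric.ball_mem_nhds t
      (show (0 : ℝ) < (1 / 2) ^ n by positivity)] with s hs hst
    refine (dist_lim_le (f := (X · ω)) (hK N) ha ha1 (hstep N) (fun t _ ↦ hg t) hs.le hN.le (n := n) ?_).trans_lt hn
    rw [← NNReal.coe_le_coe]
    simpa using (Metric.mem_ball.1 hst).le
  classical
  refine ⟨fun ω ↦ if hω : ∀ N, dyadicSum m N (X · ω) ≠ ∞ then (hpath ω hω).choose else 0,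
    fun t ↦ ?_⟩
  -- Along the dyadic floors of `t`, `X` tends to `X t` in measure and almost surely to the
  -- constructed path, so the two limits agree.
  have h1 := tendstoInMeasure_of_lintegral_le hX hC h (tendsto_dyadicFloor t)
  refine (tendstoInMeasure_ae_unique h1 (tendstoInMeasure_of_tendsto_ae (fun n ↦ hX _) ?_)).symm
  filter_upwards [ae_dyadicSum_ne_top hX hC h] with ω hω
  rw [dif_pos hω]
  exact (hpath ω hω).choose_spec t

lemma IsContinuousVersion.lintegral_enorm_sub {Y : Ω → C(ℝ≥0, E)} (hY : IsContinuousVersion X P Y)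
    (s t : ℝ≥0) (p : ℕ) :
    ∫⁻ ω, ‖Y ω t - Y ω s‖ₑ ^ p ∂P = ∫⁻ ω, ‖X t ω - X s ω‖ₑ ^ p ∂P := by
  refine lintegral_congr_ae ?_
  filter_upwards [hY s, hY t] with ω hs ht
  rw [hs, ht]

/-- The null set is fixed for all `m` and `N` before `γ` and `T` are chosen. -/
theorem ae_exists_holderOnWith (hX : ∀ t, AEStronglyMeasurable (X t) P)
    (h : ∀ m, ∃ C ≠ ∞, ∀ s t, ∫⁻ ω, ‖X t ω - X s ω‖ₑ ^ (2 * (m + 2)) ∂P ≤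
      C * (nndist s t : ℝ≥0∞) ^ (m + 2))
    {Y : Ω → C(ℝ≥0, E)} (hY : IsContinuousVersion X P Y) :
    ∀ᵐ ω ∂P, ∀ γ : ℝ≥0, (γ : ℝ) < 1 / 2 → ∀ T : ℝ≥0,
      ∃ C : ℝ≥0, HolderOnWith C γ (Y ω) (Set.Icc 0 T) := by
  have hfin : ∀ᵐ ω ∂P, ∀ m N, dyadicSum m N (Y ω) ≠ ∞ := by
    refine ae_all_iff.2 fun m ↦ ?_
    obtain ⟨C, hC, hCX⟩ := h m
    refine ae_dyadicSum_ne_top (X := fun t ω ↦ Y ω t) (fun t ↦ (hX t).congr (hY t).symm) hC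
      fun s t ↦ ?_
    rw [hY.lintegral_enorm_sub]
    exact hCX s t
  filter_upwards [hfin] with ω hω γ hγ T
  obtain ⟨m, hm, hγm⟩ := exists_lt_holderExponent hγ
  exact exists_holderOnWith_of_dyadicSum_ne_top hm (Y ω).continuous (hω m) hγm T

lemma measure_le_enorm_le_lintegral {f : Ω → E} (hf : AEStronglyMeasurable f P) {ε : ℝ}
    (hε : 0 < ε) : P {ω | ε ≤ ‖f ω‖} ≤ (∫⁻ ω, ‖f ω‖ₑ ^ 2 ∂P) / ENNReal.ofReal (ε ^ 2) := by
  rw [ENNReal.le_div_iff_mul_le (Or.inl (by positivity)) (Or.inl (by finiteness)), mul_comm]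
  refine le_trans ?_ (mul_meas_ge_le_lintegral₀ (hf.enorm.pow_const 2)
    (ENNReal.ofReal (ε ^ 2)))
  refine mul_le_mul_right (measure_mono fun ω (hω : ε ≤ ‖f ω‖) ↦ ?_) _
  rw [Set.mem_ofPred_eq]
  rw [← ofReal_norm, ← ENNReal.ofReal_pow (norm_nonneg _)]
  gcongr

/-- Continuous processes with uniform moment bounds on their increments that tend to zero pointwise
in `L²` tend to zero in probability, uniformly on compact intervals. -/
theorem tendstoInMeasure_restrict_zero {ι : Type*} {l : Filter ι} {D : ι → Ω → C(ℝ≥0, E)}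
    (hm : 1 ≤ m) (hD : ∀ i t, AEStronglyMeasurable (fun ω ↦ D i ω t) P) (hC : C ≠ ∞)
    (h : ∀ i s t, ∫⁻ ω, ‖D i ω t - D i ω s‖ₑ ^ (2 * (m + 2)) ∂P ≤
      C * (nndist s t : ℝ≥0∞) ^ (m + 2))
    (h0 : ∀ t, Tendsto (fun i ↦ ∫⁻ ω, ‖D i ω t‖ₑ ^ 2 ∂P) l (𝓝 0)) (T : ℝ≥0) :
    TendstoInMeasure P (fun i ω ↦ (D i ω).restrict (Set.Icc 0 T)) l 0 := by
  rw [tendstoInMeasure_iff_norm]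
  intro ε hε
  simp only [Pi.zero_apply, sub_zero]
  obtain ⟨N, hN⟩ := exists_nat_ge T
  have ha := dyadicRatio_nonneg m
  have ha1 := dyadicRatio_lt_one hm
  have ha0 : 0 < dyadicRatio m := by unfold dyadicRatio; positivity
  have ha2 : 0 < 1 - dyadicRatio m := by linarith
  -- Chosen so that the chaining error beyond level `n` is at most `ε / 4`, while `K n → ∞` makes a
  -- large dyadic sum unlikely uniformly in `i`.
  set K : ℕ → ℝ := fun n ↦ ε / 4 * (1 - dyadicRatio m) * (dyadicRatio m)⁻¹ ^ n with hKdef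
  have hK (n : ℕ) : 0 < K n := by positivity
  have hKeq (n : ℕ) : K n / (1 - dyadicRatio m) * dyadicRatio m ^ n = ε / 4 := by
    rw [hKdef]; simp only [inv_pow]; field_simp
  -- A norm of at least `ε` forces a large dyadic sum or a large value at one of the `N 2^n + 1`
  -- grid points, since `ε / 2 + ε / 4 < ε`.
  have hincl (i : ι) (n : ℕ) : {ω | ε ≤ ‖(D i ω).restrict (Set.Icc 0 T)‖} ⊆
      {ω | ENNReal.ofReal (K n) ^ (2 * (m + 2)) ≤ dyadicSum m N (D i ω)} ∪
      ⋃ k ∈ Finset.range (N * 2 ^ n + 1), {ω | ε / 2 ≤ ‖D i ω (dyadicPoint n k)‖} := by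
    intro ω hω
    by_contra hcon
    simp only [Set.mem_union, Set.mem_ofPred_eq, Set.mem_iUnion, not_or, not_le, not_exists,
      Finset.mem_range] at hcon
    refine not_lt.2 hω ((ContinuousMap.norm_lt_iff _ hε).2 fun t ↦ ?_)
    have ht : (t : ℝ≥0) ≤ N := t.2.2.trans hN
    have hd := dist_dyadicFloor_lim_le (hK n).le ha ha1
      (norm_sub_le_of_dyadicSum_le (hK n).le hcon.1.le) ht
      (((D i ω).continuous.tendsto _).comp (tendsto_dyadicFloor _)) n
    rw [hKeq] at hd
    have hk : ⌊2 ^ n * (t : ℝ≥0)⌋₊ < N * 2 ^ n + 1 := by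
      have : (⌊2 ^ n * (t : ℝ≥0)⌋₊ : ℝ≥0) ≤ (N * 2 ^ n : ℕ) := by
        refine (Nat.floor_le zero_le).trans ?_
        push_cast; rw [mul_comm]; gcongr
      exact Nat.lt_succ_of_le (by exact_mod_cast this)
    have h2 : ‖D i ω (dyadicFloor n t)‖ < ε / 2 := hcon.2 _ hk
    rw [dist_comm, dist_eq_norm] at hd
    have h3 := norm_sub_norm_le (D i ω t) (D i ω (dyadicFloor n t))
    rw [ContinuousMap.restrict_apply]
    linarith
  have hbound (i : ι) (n : ℕ) : P {ω | ε ≤ ‖(D i ω).restrict (Set.Icc 0 T)‖} ≤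
      N * C * 2 / ENNReal.ofReal (K n) ^ (2 * (m + 2)) +
      ∑ k ∈ Finset.range (N * 2 ^ n + 1),
        (∫⁻ ω, ‖D i ω (dyadicPoint n k)‖ₑ ^ 2 ∂P) / ENNReal.ofReal ((ε / 2) ^ 2) := by
    refine (measure_mono (hincl i n)).trans ((measure_union_le _ _).trans (add_le_add ?_ ?_))
    · have hKn := hK n
      rw [ENNReal.le_div_iff_mul_le (Or.inl (by positivity)) (Or.inl (by finiteness)), mul_comm]
      exact (mul_meas_ge_le_lintegral₀ (aemeasurable_dyadicSum (X := fun t ω ↦ D i ω t) (hD i) m N)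
        _).trans (lintegral_dyadicSum_le (X := fun t ω ↦ D i ω t) (hD i) (h i) N)
    · refine (measure_biUnion_finset_le _ _).trans (Finset.sum_le_sum fun k _ ↦ ?_)
      exact measure_le_enorm_le_lintegral (hD i _) (by positivity)
  have hKtop : Tendsto (fun n ↦ ENNReal.ofReal (K n) ^ (2 * (m + 2))) atTop (𝓝 ∞) := by
    have h1 : Tendsto K atTop atTop :=
      (tendsto_pow_atTop_atTop_of_one_lt ((one_lt_inv₀ ha0).2 ha1)).const_mul_atTop (by positivity)
    have h2 := ENNReal.tendsto_ofReal_nhds_top.2 h1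
    have h3 := ENNReal.Tendsto.pow (n := 2 * (m + 2)) h2
    rwa [ENNReal.top_pow (by omega)] at h3
  rw [ENNReal.tendsto_nhds_zero]
  intro δ hδ
  have hδ2 : 0 < δ / 2 := ENNReal.half_pos hδ.ne'
  have h1 : Tendsto (fun n ↦ N * C * 2 / ENNReal.ofReal (K n) ^ (2 * (m + 2))) atTop (𝓝 0) := by
    have := ENNReal.Tendsto.const_div hKtop (a := N * C * 2) (Or.inr (by finiteness))
    rwa [ENNReal.div_top] at this
  -- The level is fixed first, independently of `i`; then only finitely many grid points remain to
  -- be controlled.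
  obtain ⟨n, hn⟩ := (ENNReal.tendsto_nhds_zero.1 h1 _ hδ2).exists
  have h2 : Tendsto (fun i ↦ ∑ k ∈ Finset.range (N * 2 ^ n + 1),
      (∫⁻ ω, ‖D i ω (dyadicPoint n k)‖ₑ ^ 2 ∂P) / ENNReal.ofReal ((ε / 2) ^ 2)) l (𝓝 0) := by
    have := tendsto_finsetSum (Finset.range (N * 2 ^ n + 1)) fun k _ ↦
      ENNReal.Tendsto.div_const (h0 (dyadicPoint n k)) (b := ENNReal.ofReal ((ε / 2) ^ 2))
        (Or.inr (by positivity))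
    simpa using this
  filter_upwards [ENNReal.tendsto_nhds_zero.1 h2 _ hδ2] with i hi
  exact (hbound i n).trans ((add_le_add hn hi).trans_eq (ENNReal.add_halves δ))

end Kolmogorov

/-! ### Borel measurability of path-valued maps. -/

section Measurability

variable {Ω K E : Type*} [TopologicalSpace K] [CompactSpace K]
  [SecondCountableTopology K] [LocallyCompactSpace K] [NormedAddCommGroup E] [SecondCountableTopology E]
  [MeasurableSpace E] [BorelSpace E] [MeasurableSpace C(K, E)] [BorelSpace C(K, E)]

/-- A norm distance is a supremum over a dense sequence, and by second countability an open set of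
paths is a countable union of balls. -/
lemma measurable_continuousMap_of_eval [MeasurableSpace Ω] {F : Ω → C(K, E)}
    (hF : ∀ x, Measurable fun ω ↦ F ω x) : Measurable F := by
  rcases isEmpty_or_nonempty K with hK | hK
  · have : Subsingleton C(K, E) := ⟨fun f g ↦ by ext x; exact hK.elim x⟩
    exact measurable_of_subsingleton_codomain F
  have hnorm (f : C(K, E)) : Measurable fun ω ↦ ‖F ω - f‖ := by
    refine measurable_of_Iic fun c ↦ ?_
    have e : (fun ω ↦ ‖F ω - f‖) ⁻¹' Set.Iic c =
        ⋂ n, {ω | ‖F ω (TopologicalSpace.denseSeq K n) - f (TopologicalSpace.denseSeq K n)‖ ≤ c} := by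
      ext ω
      simp only [Set.mem_preimage, Set.mem_Iic, Set.mem_iInter, Set.mem_ofPred_eq]
      rw [ContinuousMap.norm_le_of_nonempty]
      refine ⟨fun h n ↦ h _, fun h x ↦ ?_⟩
      have hcl : IsClosed {x | ‖(F ω - f) x‖ ≤ c} :=
        isClosed_le (F ω - f).continuous.norm continuous_const
      have := hcl.closure_subset_iff.2 (Set.range_subset_iff.2 h)
      rw [(TopologicalSpace.denseRange_denseSeq K).closure_range] at this
      exact this (Set.mem_univ x)
    rw [e]
    exact MeasurableSet.iInter fun n ↦ measurableSet_le ((hF _).sub_const _).norm measurable_const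
  refine measurable_of_isOpen fun U hU ↦ ?_
  have hball (f : U) : ∃ r > 0, Metric.ball (f : C(K, E)) r ⊆ U := Metric.isOpen_iff.1 hU f f.2
  choose r hr hrU using hball
  obtain ⟨S, hS, hSU⟩ := TopologicalSpace.isOpen_iUnion_countable
    (fun f : U ↦ Metric.ball (f : C(K, E)) (r f)) fun f ↦ Metric.isOpen_ball
  have e : U = ⋃ f ∈ S, Metric.ball (f : C(K, E)) (r f) := by
    rw [hSU]
    refine Set.Subset.antisymm (fun f hf ↦ ?_) (Set.iUnion_subset hrU)
    exact Set.mem_iUnion.2 ⟨⟨f, hf⟩, Metric.mem_ball_self (hr _)⟩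
  rw [e, Set.preimage_iUnion₂]
  refine MeasurableSet.biUnion hS fun f _ ↦ ?_
  have : F ⁻¹' Metric.ball (f : C(K, E)) (r f) = {ω | ‖F ω - f‖ < r f} := by
    ext ω; simp [dist_eq_norm]
  rw [this]
  exact measurableSet_lt (hnorm f) measurable_const

lemma aemeasurable_continuousMap_of_eval [MeasurableSpace Ω] {P : Measure Ω} {F : Ω → C(K, E)}
    (hF : ∀ x, AEMeasurable (fun ω ↦ F ω x) P) : AEMeasurable F P := by
  have h : NullMeasurable F P :=
    @measurable_continuousMap_of_eval (NullMeasurableSpace Ω P) K E _ _ _ _ _ _ _ _ _ _ _ F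
      fun x ↦ (hF x).nullMeasurable
  exact h.aemeasurable

end Measurability

/-! ### Estimates for the interpolating process and its limit. -/

section Interpolation

variable {d : ℕ} {Ω : Type*} [MeasurableSpace Ω] {P : Measure Ω}
  {W : ℝ≥0 → Ω → EuclideanSpace ℝ (Fin d)} {β : ℝ} {z : EuclideanSpace ℝ (Fin d)}

lemma interpolationProcess_sub_apply (t : ℝ≥0) (ω : Ω) (i : Fin d) :
    (interpolationProcess W P β z t ω - z) i =
      √β * wienerIntegral (fun t ω ↦ W t ω i) P (interpolationKernel β t) ω := by
  simp [interpolationProcess]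

lemma isWienerIntegral_sqrt_mul (hW : IsBrownianMotion W P) (hβ : β ∈ Set.Ioo (0 : ℝ) 1)
    (t : ℝ≥0) (i : Fin d) :
    IsWienerIntegral (fun t ω ↦ W t ω i) P (fun u ↦ √β * interpolationKernel β t u)
      (fun ω ↦ (interpolationProcess W P β z t ω - z) i) := by
  have hB := (hW.isBrownianReal i).toIsPreBrownianReal
  have h := isWienerIntegral_wienerIntegral hB hβ t
  simp only [interpolationProcess_sub_apply]
  -- A scalar multiple, as a linear combination with second weight zero.
  simpa using h.linComb hB h (√β) 0

lemma aestronglyMeasurable_interpolationProcess (hW : IsBrownianMotion W P)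
    (hβ : β ∈ Set.Ioo (0 : ℝ) 1) (t : ℝ≥0) :
    AEStronglyMeasurable (interpolationProcess W P β z t) P := by
  have h : AEMeasurable (fun ω ↦ z + WithLp.toLp 2 fun i ↦
      (interpolationProcess W P β z t ω - z) i) P :=
    ((WithLp.measurable_toLp 2 _).comp_aemeasurable (aemeasurable_pi_lambda _ fun i ↦
      (isWienerIntegral_sqrt_mul hW hβ t i).memLp_integral.1.aemeasurable)).const_add z
  refine (h.congr (ae_of_all _ fun ω ↦ ?_)).aestronglyMeasurable
  ext i; simp

/-- Moments of a linear combination of two values of the centred process. -/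
lemma lintegral_enorm_linComb_le (hW : IsBrownianMotion W P) (hβ : β ∈ Set.Ioo (0 : ℝ) 1)
    (a b : ℝ) (s t : ℝ≥0) {w : ℝ≥0}
    (hw : ∫ u in Set.Ioi 0, (a * (√β * interpolationKernel β s u)
        + b * (√β * interpolationKernel β t u)) ^ 2 ≤ (w : ℝ)) (m : ℕ) :
    ∫⁻ ω, ‖a • (interpolationProcess W P β z s ω - z) +
      b • (interpolationProcess W P β z t ω - z)‖ₑ ^ (2 * (m + 1)) ∂P ≤
        vectorMomentConst d m * w ^ (m + 1) := by
  refine lintegral_enorm_pow_le_of_hasLaw_gaussianReal (v := fun _ ↦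
    (∫ u in Set.Ioi 0, (a * (√β * interpolationKernel β s u)
        + b * (√β * interpolationKernel β t u)) ^ 2).toNNReal) (fun i ↦ ?_)
    (fun i ↦ Real.toNNReal_le_iff_le_coe.2 hw) m
  have hB := (hW.isBrownianReal i).toIsPreBrownianReal
  exact ((isWienerIntegral_sqrt_mul (z := z) hW hβ s i).linComb hB
    (isWienerIntegral_sqrt_mul (z := z) hW hβ t i) a b).hasLaw hB

lemma lintegral_enorm_interpolationProcess_sub_le (hW : IsBrownianMotion W P)
    (hβ : β ∈ Set.Ioo (0 : ℝ) 1) (m : ℕ) (s t : ℝ≥0) :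
    ∫⁻ ω, ‖(interpolationProcess W P β z t ω) - (interpolationProcess W P β z s ω)‖ₑ ^
      (2 * (m + 2)) ∂P ≤ vectorMomentConst d (m + 1) * (nndist s t : ℝ≥0∞) ^ (m + 2) := by
  have h := lintegral_enorm_linComb_le (z := z) hW hβ 1 (-1) t s
    (integral_sq_interpolationKernel_sub_le hβ t s) (m + 1)
  rw [nndist_comm]
  refine le_trans (le_of_eq (lintegral_congr fun ω ↦ ?_)) h
  congr 2
  module

/-- At time one the centred process is a standard Gaussian vector, whatever `β` is. -/
lemma hasLaw_interpolationProcess_one [IsProbabilityMeasure P] (hW : IsBrownianMotion W P)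
    (hβ : β ∈ Set.Ioo (0 : ℝ) 1) :
    HasLaw (fun ω ↦ interpolationProcess W P β z 1 ω - z)
      (stdGaussian (EuclideanSpace ℝ (Fin d))) P := by
  have h := integral_sq_interpolationKernel_linComb hβ.1 1 0 1 1
  simp only [one_mul, zero_mul, add_zero] at h
  exact hasLaw_stdGaussian_of_isWienerIntegral hW
    (fun i ↦ isWienerIntegral_sqrt_mul (z := z) hW hβ 1 i) (h.trans (by simp))

/-- The distance of a path to the path `t ↦ z + √t c` with the same value at time one. -/
noncomputable def sqrtPathError (z : EuclideanSpace ℝ (Fin d))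
    (y : C(ℝ≥0, EuclideanSpace ℝ (Fin d))) : C(ℝ≥0, EuclideanSpace ℝ (Fin d)) :=
  y - sqrtPath z (y 1 - z)

lemma sqrtPathError_apply (y : C(ℝ≥0, EuclideanSpace ℝ (Fin d))) (t : ℝ≥0) :
    sqrtPathError z y t = (1 : ℝ) • (y t - z) + (-√(t : ℝ)) • (y 1 - z) := by
  change y t - (z + √(t : ℝ) • (y 1 - z)) = _
  module

/-- From `|√t - √s| ≤ √t + √s` follows `(√t - √s)² ≤ |t - s|`. -/
lemma enorm_sqrt_sub_sqrt_pow_le (s t : ℝ≥0) (m : ℕ) :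
    ‖√(t : ℝ) - √(s : ℝ)‖ₑ ^ (2 * m) ≤ (nndist s t : ℝ≥0∞) ^ m := by
  rw [pow_mul]
  gcongr
  rw [← ofReal_norm, ← ENNReal.ofReal_pow (norm_nonneg _), ← edist_nndist, edist_dist]
  refine ENNReal.ofReal_le_ofReal ?_
  rw [NNReal.dist_eq, Real.norm_eq_abs, sq_abs]
  have hs := Real.sq_sqrt s.coe_nonneg
  have ht := Real.sq_sqrt t.coe_nonneg
  have hs0 := Real.sqrt_nonneg (s : ℝ)
  have ht0 := Real.sqrt_nonneg (t : ℝ)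
  calc (√(t : ℝ) - √(s : ℝ)) ^ 2 = |√(t : ℝ) - √(s : ℝ)| * |√(s : ℝ) - √(t : ℝ)| := by
        rw [abs_sub_comm (√(s : ℝ)), abs_mul_abs_self, sq]
    _ ≤ |√(t : ℝ) + √(s : ℝ)| * |√(s : ℝ) - √(t : ℝ)| := by
        gcongr ?_ * _
        rw [abs_of_nonneg (add_nonneg ht0 hs0), abs_le]
        constructor <;> linarith
    _ = |(s : ℝ) - t| := by
        rw [← abs_mul]
        congr 1
        linear_combination hs - ht

/-- An increment of the error is one of `Y` minus `√t - √s` times `Y 1 - z`; both parts obey the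
same bound, with a constant that does not depend on `β`. -/
lemma lintegral_enorm_sqrtPathError_sub_le (hW : IsBrownianMotion W P)
    (hβ : β ∈ Set.Ioo (0 : ℝ) 1) {Y : Ω → C(ℝ≥0, EuclideanSpace ℝ (Fin d))}
    (hY : IsContinuousVersion (interpolationProcess W P β z) P Y) (m : ℕ) (s t : ℝ≥0) :
    ∫⁻ ω, ‖sqrtPathError z (Y ω) t - sqrtPathError z (Y ω) s‖ₑ ^ (2 * (m + 2)) ∂P ≤
      (2 ^ (2 * (m + 2)) * (vectorMomentConst d (m + 1) + vectorMomentConst d (m + 1))) *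
        (nndist s t : ℝ≥0∞) ^ (m + 2) := by
  have hX (t : ℝ≥0) := aestronglyMeasurable_interpolationProcess (z := z) hW hβ t
  have hYm (t : ℝ≥0) : AEStronglyMeasurable (fun ω ↦ Y ω t) P := (hX t).congr (hY t).symm
  have h1 := lintegral_enorm_interpolationProcess_sub_le (z := z) hW hβ m s t
  rw [← hY.lintegral_enorm_sub] at h1
  have h2 : ∫⁻ ω, ‖Y ω 1 - z‖ₑ ^ (2 * (m + 2)) ∂P ≤ vectorMomentConst d (m + 1) := by
    have h := lintegral_enorm_linComb_le (z := z) hW hβ 1 0 1 1 (w := 1)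
      (by rw [integral_sq_interpolationKernel_linComb hβ.1]; simp) (m + 1)
    simp only [ENNReal.coe_one, one_pow, mul_one, one_smul, zero_smul, add_zero] at h
    refine le_trans (le_of_eq (lintegral_congr_ae ?_)) h
    filter_upwards [hY 1] with ω hω
    rw [hω]
  have hpt (ω : Ω) : ‖sqrtPathError z (Y ω) t - sqrtPathError z (Y ω) s‖ₑ ^ (2 * (m + 2)) ≤
      2 ^ (2 * (m + 2)) * (‖Y ω t - Y ω s‖ₑ ^ (2 * (m + 2)) +
        (nndist s t : ℝ≥0∞) ^ (m + 2) * ‖Y ω 1 - z‖ₑ ^ (2 * (m + 2))) := by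
    have e : sqrtPathError z (Y ω) t - sqrtPathError z (Y ω) s =
        (Y ω t - Y ω s) - (√(t : ℝ) - √(s : ℝ)) • (Y ω 1 - z) := by
      rw [sqrtPathError_apply, sqrtPathError_apply]; module
    have hle : ∀ a b : ℝ≥0∞, ∀ p : ℕ, (a + b) ^ p ≤ 2 ^ p * (a ^ p + b ^ p) := by
      intro a b p
      calc (a + b) ^ p ≤ (2 * max a b) ^ p := by
            rw [two_mul]; gcongr <;> simp
        _ = 2 ^ p * max a b ^ p := mul_pow _ _ _
        _ ≤ 2 ^ p * (a ^ p + b ^ p) := by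
            gcongr
            rcases max_choice a b with h | h <;> rw [h] <;> simp
    calc ‖sqrtPathError z (Y ω) t - sqrtPathError z (Y ω) s‖ₑ ^ (2 * (m + 2))
        ≤ (‖Y ω t - Y ω s‖ₑ + ‖√(t : ℝ) - √(s : ℝ)‖ₑ * ‖Y ω 1 - z‖ₑ) ^ (2 * (m + 2)) := by
          rw [e, ← enorm_smul]
          gcongr
          exact enorm_sub_le
      _ ≤ 2 ^ (2 * (m + 2)) * (‖Y ω t - Y ω s‖ₑ ^ (2 * (m + 2)) +
            (‖√(t : ℝ) - √(s : ℝ)‖ₑ * ‖Y ω 1 - z‖ₑ) ^ (2 * (m + 2))) := hle _ _ _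
      _ ≤ _ := by
          rw [mul_pow]
          have hsqrt := enorm_sqrt_sub_sqrt_pow_le s t (m + 2)
          exact mul_le_mul_right (add_le_add_right (mul_le_mul_left hsqrt _) _) _
  have hm : AEMeasurable (fun ω ↦ ‖Y ω t - Y ω s‖ₑ ^ (2 * (m + 2))) P :=
    ((hYm t).sub (hYm s)).enorm.pow_const _
  refine (lintegral_mono hpt).trans ?_
  rw [lintegral_const_mul' _ _ (by finiteness),
    lintegral_add_left' hm,
    lintegral_const_mul' _ _ (by finiteness)]
  calc _ ≤ 2 ^ (2 * (m + 2)) * (vectorMomentConst d (m + 1) * (nndist s t : ℝ≥0∞) ^ (m + 2) +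
        (nndist s t : ℝ≥0∞) ^ (m + 2) * vectorMomentConst d (m + 1)) := by gcongr
    _ = _ := by ring

lemma tendsto_lintegral_enorm_sqrtPathError (hW : IsBrownianMotion W P)
    {Y : Set.Ioo (0 : ℝ) 1 → Ω → C(ℝ≥0, EuclideanSpace ℝ (Fin d))}
    (hY : ∀ β : Set.Ioo (0 : ℝ) 1, IsContinuousVersion (interpolationProcess W P β z) P (Y β))
    (t : ℝ≥0) :
    Tendsto (fun β ↦ ∫⁻ ω, ‖sqrtPathError z (Y β ω) t‖ₑ ^ 2 ∂P)
      (comap (Subtype.val : Set.Ioo (0 : ℝ) 1 → ℝ) (𝓝 0)) (𝓝 0) := by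
  have hv := ((tendsto_interpolationKernel_variance t).comp
    (tendsto_comap (f := (Subtype.val : Set.Ioo (0 : ℝ) 1 → ℝ))))
  have hlim := ENNReal.Tendsto.const_mul (ENNReal.tendsto_ofReal hv)
    (Or.inr (vectorMomentConst_ne_top d 0))
  rw [ENNReal.ofReal_zero, mul_zero] at hlim
  refine tendsto_of_tendsto_of_tendsto_of_le_of_le tendsto_const_nhds hlim (fun _ ↦ zero_le)
    fun β ↦ ?_
  have h := lintegral_enorm_linComb_le (z := z) hW β.2 1 (-√(t : ℝ)) t 1
    (Real.le_coe_toNNReal _) 0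
  rw [integral_sq_interpolationKernel_linComb β.2.1, zero_add, pow_one] at h
  refine le_trans (le_of_eq (lintegral_congr_ae ?_)) h
  filter_upwards [hY β t, hY β 1] with ω h1 h2
  rw [sqrtPathError_apply, h1, h2]

lemma continuous_restrict_sqrtPath (z : EuclideanSpace ℝ (Fin d)) (T : ℝ≥0) :
    Continuous fun c : EuclideanSpace ℝ (Fin d) ↦ (sqrtPath z c).restrict (Set.Icc 0 T) := by
  refine ContinuousMap.continuous_of_continuous_uncurry _ ?_
  change Continuous fun p : EuclideanSpace ℝ (Fin d) × Set.Icc 0 T ↦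
    z + √((p.2 : ℝ≥0) : ℝ) • p.1
  fun_prop

theorem tendstoInDistribution_interpolationProcess [IsProbabilityMeasure P]
    (hW : IsBrownianMotion W P) {Ω' : Type*} [MeasurableSpace Ω'] {P' : Measure Ω'}
    [IsProbabilityMeasure P'] {η : Ω' → EuclideanSpace ℝ (Fin d)}
    (hη : HasLaw η (stdGaussian (EuclideanSpace ℝ (Fin d))) P')
    {Y : Set.Ioo (0 : ℝ) 1 → Ω → C(ℝ≥0, EuclideanSpace ℝ (Fin d))}
    (hY : ∀ β : Set.Ioo (0 : ℝ) 1, IsContinuousVersion (interpolationProcess W P β z) P (Y β))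
    (T : ℝ≥0) :
    TendstoInDistribution (fun β ω ↦ (Y β ω).restrict (Set.Icc 0 T))
      (comap (Subtype.val : Set.Ioo (0 : ℝ) 1 → ℝ) (𝓝 0))
      (fun ω ↦ (sqrtPath z (η ω)).restrict (Set.Icc 0 T)) (fun _ ↦ P) P' := by
  have hYm (β : Set.Ioo (0 : ℝ) 1) (t : ℝ≥0) : AEStronglyMeasurable (fun ω ↦ Y β ω t) P :=
    (aestronglyMeasurable_interpolationProcess hW β.2 t).congr (hY β t).symm
  have hlaw (β : Set.Ioo (0 : ℝ) 1) : HasLaw (fun ω ↦ Y β ω 1 - z)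
      (stdGaussian (EuclideanSpace ℝ (Fin d))) P := by
    refine (hasLaw_interpolationProcess_one (z := z) hW β.2).congr ?_
    filter_upwards [hY β 1] with ω hω
    rw [hω]
  -- The law does not depend on `β`, so this convergence is trivial; `1 / 2` is an arbitrary
  -- reference value.
  have hconv : TendstoInDistribution (fun (β : Set.Ioo (0 : ℝ) 1) ω ↦ Y β ω 1 - z)
      (comap (Subtype.val : Set.Ioo (0 : ℝ) 1 → ℝ) (𝓝 0)) η (fun _ ↦ P) P' :=
    tendstoInDistribution_of_identDistrib ⟨1 / 2, by norm_num⟩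
      (fun β ↦ ⟨(hlaw _).aemeasurable, (hlaw β).aemeasurable,
        (hlaw _).map_eq.trans (hlaw β).map_eq.symm⟩)
      ⟨(hlaw _).aemeasurable, hη.aemeasurable, (hlaw _).map_eq.trans hη.map_eq.symm⟩
  have hconv' := hconv.continuous_comp (continuous_restrict_sqrtPath z T)
  have hmeas (β : Set.Ioo (0 : ℝ) 1) :
      AEMeasurable (fun ω ↦ (Y β ω).restrict (Set.Icc 0 T)) P :=
    aemeasurable_continuousMap_of_eval fun t ↦ (hYm β t).aemeasurable
  have hC : 2 ^ (2 * (1 + 2)) * (vectorMomentConst d (1 + 1) + vectorMomentConst d (1 + 1)) ≠ ∞ := by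
    have := vectorMomentConst_ne_top d (1 + 1)
    finiteness
  have hDm (β : Set.Ioo (0 : ℝ) 1) (t : ℝ≥0) :
      AEStronglyMeasurable (fun ω ↦ sqrtPathError z (Y β ω) t) P := by
    have hc : Continuous fun p : EuclideanSpace ℝ (Fin d) × EuclideanSpace ℝ (Fin d) ↦
        (1 : ℝ) • (p.1 - z) + (-√(t : ℝ)) • (p.2 - z) := by fun_prop
    refine (hc.comp_aestronglyMeasurable ((hYm β t).prodMk (hYm β 1))).congr
      (ae_of_all _ fun ω ↦ (sqrtPathError_apply _ _).symm)
  have herr : TendstoInMeasure P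
      (fun (β : Set.Ioo (0 : ℝ) 1) ω ↦ (sqrtPathError z (Y β ω)).restrict (Set.Icc 0 T))
      (comap (Subtype.val : Set.Ioo (0 : ℝ) 1 → ℝ) (𝓝 0)) 0 :=
    tendstoInMeasure_restrict_zero (D := fun β ω ↦ sqrtPathError z (Y β ω)) le_rfl hDm hC
      (fun β s t ↦ lintegral_enorm_sqrtPathError_sub_le hW β.2 (hY β) 1 s t)
      (tendsto_lintegral_enorm_sqrtPathError hW hY) T
  have hsub : (fun (β : Set.Ioo (0 : ℝ) 1) ω ↦ (sqrtPathError z (Y β ω)).restrict (Set.Icc 0 T)) =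
      (fun (β : Set.Ioo (0 : ℝ) 1) ω ↦ (Y β ω).restrict (Set.Icc 0 T)) -
      fun (β : Set.Ioo (0 : ℝ) 1) ω ↦ (sqrtPath z (Y β ω 1 - z)).restrict (Set.Icc 0 T) := by
    ext β ω t i
    rfl
  rw [hsub] at herr
  -- Slutsky: the path differs from a family converging in law by an error that vanishes in
  -- probability.
  exact tendstoInDistribution_of_tendstoInMeasure_sub
    (fun (β : Set.Ioo (0 : ℝ) 1) ω ↦ (Y β ω).restrict (Set.Icc 0 T)) _ hconv' herr hmeas

end Interpolation

theorem mainTheorem12 {d : ℕ}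
    {Ω : Type*} [MeasurableSpace Ω] (P : Measure Ω) [IsProbabilityMeasure P]
    (W : ℝ≥0 → Ω → EuclideanSpace ℝ (Fin d)) (hW : IsBrownianMotion W P)
    {Ω' : Type*} [MeasurableSpace Ω'] (P' : Measure Ω') [IsProbabilityMeasure P']
    (η : Ω' → EuclideanSpace ℝ (Fin d))
    (hη : HasLaw η (stdGaussian (EuclideanSpace ℝ (Fin d))) P')
    (z : EuclideanSpace ℝ (Fin d)) :
    (∀ β ∈ Set.Ioo (0 : ℝ) 1,
      (∃ Y : Ω → C(ℝ≥0, EuclideanSpace ℝ (Fin d)),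
        IsContinuousVersion (interpolationProcess W P β z) P Y) ∧
      ∀ Y : Ω → C(ℝ≥0, EuclideanSpace ℝ (Fin d)),
        IsContinuousVersion (interpolationProcess W P β z) P Y →
        ∀ᵐ ω ∂P, ∀ γ : ℝ≥0, 0 < γ → (γ : ℝ) < 1 / 2 → ∀ T : ℝ≥0,
          ∃ C : ℝ≥0, HolderOnWith C γ (Y ω) (Set.Icc 0 T)) ∧
    ∀ Y : Set.Ioo (0 : ℝ) 1 → Ω → C(ℝ≥0, EuclideanSpace ℝ (Fin d)),
      (∀ β : Set.Ioo (0 : ℝ) 1, IsContinuousVersion (interpolationProcess W P β z) P (Y β)) →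
      ∀ T : ℝ≥0, 0 < T →
        TendstoInDistribution
          (fun β ω ↦ (Y β ω).restrict (Set.Icc 0 T))
          (comap (Subtype.val : Set.Ioo (0 : ℝ) 1 → ℝ) (𝓝 0))
          (fun ω ↦ (sqrtPath z (η ω)).restrict (Set.Icc 0 T))
          (fun _ ↦ P) P' := by
  refine ⟨fun β hβ ↦ ?_, fun Y hY T _ ↦ tendstoInDistribution_interpolationProcess hW hη hY T⟩
  have hX (t : ℝ≥0) := aestronglyMeasurable_interpolationProcess (z := z) hW hβ t
  -- Sixth moments, `m = 1`, suffice for a continuous version; Hölder orders close to `1/2` need all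
  -- `m`.
  refine ⟨exists_isContinuousVersion le_rfl hX (vectorMomentConst_ne_top d (1 + 1))
    (lintegral_enorm_interpolationProcess_sub_le hW hβ 1), fun Y hY ↦ ?_⟩
  filter_upwards [ae_exists_holderOnWith hX (fun m ↦ ⟨_, vectorMomentConst_ne_top d (m + 1),
    lintegral_enorm_interpolationProcess_sub_le hW hβ m⟩) hY] with ω hω γ _ hγ T
  exact hω γ hγ T
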